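/- Fix an integer $l\ge 1$. A *vector composition* is a finite (possibly empty) sequence $I=(i_1,\dots,i_m)$ of nonzero columns $i_r\in\mathbb N^l$ (coordinates numbered $0,\dots,l-1$); put $\ell(I)=m$, $\Sigma I=i_1+\dots+i_m$, $|i|$ = sum of the entries of a column $i$, $|I|=\sum_r|i_r|$, and $D(I)=\{|i_1|,|i_1|+|i_2|,\dots,|i_1|+\dots+|i_{m-1}|\}$. The coloring word $c(I)$ is obtained by reading the columns from left to right, writing for each column the color $0$ as often as its $0$-th entry says, then the color $1$, and so on. Write $J\trianglelefteq I$ if $I$ is a concatenation of vector compositions $I_1\cdots I_p$ with $J=(\Sigma I_1,\dots,\Sigma I_p)$. For a color word $u=u_1\cdots u_n$ in the alphabet $\{0,\dots,l-1\}$ let $E_u=(e_{u_1},\dots,e_{u_n})$, where the $e_i$ are the coordinate vectors. Let $\mathrm{QSym}^{(l)}$ be the space of level-$l$ quasisymmetric functions: the formal power series over $\mathbb Q$ of finite degree in commuting variables $x^{(i)}_j$ ($0\le i<l$, $j\ge1$) in which the coefficient of $x_{j_1}^{i_1}\cdots x_{j_m}^{i_m}$ with $j_1<\dots<j_m$ depends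 only on the vector composition $(i_1,\dots,i_m)$; here $x_j^{i}=\prod_r (x_j^{(r)})^{i_r}$ for a column $i$ with entries $i_0,\dots,i_{l-1}$. It is $\mathbb N^l$-graded, it has the basis $M_I=\sum_{j_1<\dots<j_m}x_{j_1}^{i_1}\cdots x_{j_m}^{i_m}$ ($M_I$ of multidegree $\Sigma I$), and it is a coalgebra with coproduct $\Delta M_I=\sum_{I=JK}M_J\otimes M_K$ (sum over all concatenations). Let $\zeta$ be the linear functional with $\zeta(M_I)=1$ if $\ell(I)\le1$ and $\zeta(M_I)=0$ otherwise, $\zeta^{-1}$ its convolution inverse, and $\bar\zeta(h)=(-1)^{|n|}\zeta(h)$ for $h$ of multidegree $n$. The *peak algebra of level $l$*, $\mathcal O=\mathcal O^{\infty}(\mathrm{QSym}^{(l)})$, is the largest graded subcoalgebra of $\mathrm{QSym}^{(l)}$ on which $\bar\zeta=\zeta^{-1}$. For a vector composition $I$ put $$\eta_I=\sum_{J\trianglelefteq I}2^{\ell(J)}M_J .$$ For a color word $u$ of length $n$ and a *peak subset* $S$ of $[n]$ (i.e. $S\subseteq\{2,\dots,n-1\}$ without two consecutive elements) put $$\theta_{S,u}=\sum_{\substack{J\trianglelefteq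 E_u\\ S\subseteq D(J)\cup(D(J)+1)}}2^{\ell(J)}M_J .$$ The *peak set* $\mathrm{Peak}(I)$ is $D(\Lambda(I))$, where $\Lambda(I)=(\Sigma I_1,\dots,\Sigma I_p)$ for the unique factorization $I=I_1\cdots I_p$ in which $I_p$ is a (possibly empty) sequence of coordinate vectors and every other $I_j$ is a (possibly empty) sequence of coordinate vectors followed by one column of weight at least $2$; the last sum is omitted if $I_p$ is empty. If $I$ is empty or its last column has odd weight, then $\mathrm{odd}(I)=(\Sigma I_1,\dots,\Sigma I_p)$ for the unique factorization $I=I_1\cdots I_p$ in which the last column of each $I_j$ has odd weight and all its other columns have even weight. $I$ is *odd* if all its columns have odd weight; then $\tilde I$ is the vector composition with the same coloring word obtained by replacing each column by a sequence of columns of weight $2$ followed by one column of weight $1$, of the same total weight. Finally $I_{S,u}$ denotes the vector composition, unique if it exists, all of whose columns have weight $1$ or $2$, whose last column (if any) has weight $1$, whose coloring word is $u$ and whose peak set is $S$. The pair $(S,u)$ is *admissible* if $S$ is a peak subset of $[n]$, where $n$ is the length of $u$, $I_{S,u}$ exists, and $c(\mathrm{odd}(I_{S,u}))=u$. **Theorem.**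 The peak functions $\theta_{S,u}$ indexed by the admissible pairs $(S,u)$ form a $\mathbb Q$-basis of $\mathcal O$. Moreover, if $I$ is an odd vector composition and $u=c(I)$, then $$\eta_I=\sum_{S\subseteq \mathrm{Peak}(\tilde I)}(-1)^{|S|}\,\theta_{S,u},$$ and if $(S,u)$ is an admissible pair, then $I_{T,u}$ exists and is unique for every $T\subseteq S$, and $$\theta_{S,u}=\sum_{T\subseteq S}(-1)^{|T|}\,\eta_{\mathrm{odd}(I_{T,u})}.$$ -/

import Mathlib

open scoped TensorProduct

noncomputable section

namespace LevelQSym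

/-! ### Vector compositions and their combinatorics -/

/-- The weight `|n|` of an `l`-partite number `n`. -/
def wt {l : ℕ} (n : Fin l → ℕ) : ℕ := ∑ i, n i

/-- Vector compositions: finite sequences of nonzero columns in `ℕ ^ l`. -/
abbrev VComp (l : ℕ) := {L : List (Fin l → ℕ) // ∀ v ∈ L, v ≠ 0}

namespace VComp

variable {l : ℕ}

/-- The length, i.e. the number of columns. -/
def len (I : VComp l) : ℕ := I.1.length

/-- The sum of the columns, an `l`-partite number. -/
def total (I : VComp l) : Fin l → ℕ := I.1.sum

/-- The weight, i.e. the sum of the weights of the columns. -/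
def weight (I : VComp l) : ℕ := (I.1.map wt).sum

/-- The vector composition formed by the first `k` columns. -/
def take (k : ℕ) (I : VComp l) : VComp l :=
  ⟨I.1.take k, fun v hv => I.2 v (List.mem_of_mem_take hv)⟩

/-- The vector composition formed by all columns but the first `k`. -/
def drop (k : ℕ) (I : VComp l) : VComp l :=
  ⟨I.1.drop k, fun v hv => I.2 v (List.mem_of_mem_drop hv)⟩

/-- `Coarsens I J` means that `J` is a refinement of `I`: `J` is a concatenation
`J₁ ⋯ Jₘ` of vector compositions such that `Jₖ` sums to the `k`-th column of `I`. -/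
def Coarsens (I J : VComp l) : Prop :=
  ∃ P : List (VComp l), (P.map Subtype.val).flatten = J.1 ∧ P.map total = I.1

/-- The descent set `{|i₁|, |i₁| + |i₂|, …, |i₁| + ⋯ + |iₘ₋₁|}` of `(i₁, …, iₘ)`. -/
def dset (I : VComp l) : Finset ℕ :=
  (Finset.Ico 1 I.len).image fun k => (I.take k).weight

/-- The colouring word of a single column: colour `i` is repeated `v i` times,
in increasing order of the colours. -/
def colWord (v : Fin l → ℕ) : List (Fin l) :=
  (List.finRange l).flatMap fun i => List.replicate (v i) i

/-- The colouring word of a vector composition. -/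
def word (I : VComp l) : List (Fin l) := I.1.flatMap colWord

/-- The coordinate vector composition `(e_{u₁}, …, e_{uₙ})` of a colour word `u`. -/
def coord (u : List (Fin l)) : VComp l :=
  ⟨u.map fun i => Pi.single i 1, by simp⟩

/-- Odd vector compositions: all columns have odd weight. -/
def IsOdd (I : VComp l) : Prop := ∀ v ∈ I.1, Odd (wt v)

/-- Reads columns from left to right, accumulating their sum in the first argument, and
outputs the sum each time a column of odd weight has been read. -/
def oddAux : (Fin l → ℕ) → List (Fin l → ℕ) → List (Fin l → ℕ)
  | _, [] => []
  | acc, v :: L => if Odd (wt v) then (acc + v) :: oddAux 0 L else oddAux (acc + v) L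

lemma oddAux_ne_zero (L : List (Fin l → ℕ)) (hL : ∀ v ∈ L, v ≠ 0) (acc : Fin l → ℕ) :
    ∀ v ∈ oddAux acc L, v ≠ 0 := by
  induction L generalizing acc with
  | nil => simp [oddAux]
  | cons w L ih =>
    have hw : acc + w ≠ 0 := fun h => hL w (by simp) (by
      funext i; have := congrFun h i; simp at this; simp [this.2])
    have ih' := ih (fun v hv => hL v (by simp [hv]))
    unfold oddAux
    split_ifs
    · simpa [hw] using ih' 0
    · exact ih' _

/-- For a vector composition `I` whose last column has odd weight (or which is empty):
`(Σ I₁, …, Σ Iₘ)`, where `I = I₁ ⋯ Iₘ` and in each `Iⱼ` the last column has odd weight and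
the other columns have even weight. -/
def odd (I : VComp l) : VComp l := ⟨oddAux 0 I.1, oddAux_ne_zero I.1 I.2 0⟩

/-- Reads columns from left to right, accumulating their sum in the first argument, and
outputs the sum each time a column of weight different from `1` has been read; a nonzero
remainder is output at the end. -/
def peakAux : (Fin l → ℕ) → List (Fin l → ℕ) → List (Fin l → ℕ)
  | acc, [] => if acc = 0 then [] else [acc]
  | acc, v :: L => if wt v = 1 then peakAux (acc + v) L else (acc + v) :: peakAux 0 L

lemma peakAux_ne_zero (L : List (Fin l → ℕ)) (hL : ∀ v ∈ L, v ≠ 0) (acc : Fin l → ℕ) :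
    ∀ v ∈ peakAux acc L, v ≠ 0 := by
  induction L generalizing acc with
  | nil => unfold peakAux; split_ifs with h <;> simp [h]
  | cons w L ih =>
    have hw : acc + w ≠ 0 := fun h => hL w (by simp) (by
      funext i; have := congrFun h i; simp at this; simp [this.2])
    have ih' := ih (fun v hv => hL v (by simp [hv]))
    unfold peakAux
    split_ifs
    · exact ih' _
    · simpa [hw] using ih' 0

/-- The peak vector composition `Λ(I) = (Σ I₁, …, Σ Iₘ)`, where `I = I₁ ⋯ Iₘ`, the last factor
consists of coordinate vectors, and each other factor consists of coordinate vectors followed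
by one column of weight at least `2`; the last sum is omitted if `Iₘ` is empty. -/
def peak (I : VComp l) : VComp l := ⟨peakAux 0 I.1, peakAux_ne_zero I.1 I.2 0⟩

/-- The peak set of a vector composition. -/
def peakSet (I : VComp l) : Finset ℕ := I.peak.dset

/-- Cuts a word of odd length into consecutive pairs followed by one single letter, and
records the multidegrees of the pieces. -/
def pairUp : List (Fin l) → List (Fin l → ℕ)
  | [] => []
  | [a] => [Pi.single a 1]
  | a :: b :: w => (Pi.single a 1 + Pi.single b 1) :: pairUp w

lemma pairUp_ne_zero : ∀ (w : List (Fin l)), ∀ v ∈ pairUp w, v ≠ 0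
  | [] => by simp [pairUp]
  | [a] => by simp [pairUp]
  | a :: b :: w => by
    have h : (Pi.single a 1 + Pi.single b 1 : Fin l → ℕ) ≠ 0 := fun h => by
      have := congrFun h a; simp at this
    simpa [pairUp, h] using pairUp_ne_zero w

/-- For an odd vector composition `I`: every column is replaced by columns of weight `2`
followed by one column of weight `1`, in such a way that the colouring word does not change. -/
def tilde (I : VComp l) : VComp l :=
  ⟨I.1.flatMap fun v => pairUp (colWord v), fun v hv => by
    obtain ⟨w, -, hw⟩ := List.mem_flatMap.1 hv
    exact pairUp_ne_zero _ v hw⟩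

end VComp

/-- `S` is a peak subset of `{1, …, n}`: it is contained in `{2, …, n - 1}` and does not contain
two consecutive integers. -/
def IsPeakSubset (n : ℕ) (S : Finset ℕ) : Prop :=
  ∀ i ∈ S, 2 ≤ i ∧ i < n ∧ i - 1 ∉ S

/-- The defining properties of the vector composition `I_{S,u}`: all columns have weight `1` or
`2`, the last column (if there is one) has weight `1`, the colouring word is `u`, and the peak
set is `S`. -/
structure IsPeakComp {l : ℕ} (S : Finset ℕ) (u : List (Fin l)) (I : VComp l) : Prop where
  wt_mem : ∀ v ∈ I.1, wt v = 1 ∨ wt v = 2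
  wt_last : ∀ v ∈ I.1.getLast?, wt v = 1
  word_eq : I.word = u
  peakSet_eq : I.peakSet = S

open Classical in
/-- The vector composition `I_{S,u}` (the empty one, if `I_{S,u}` does not exist). -/
def peakComp {l : ℕ} (S : Finset ℕ) (u : List (Fin l)) : VComp l :=
  if h : ∃ I : VComp l, IsPeakComp S u I then h.choose else ⟨[], by simp⟩

/-- Admissible pairs `(S, u)`: `S` is a peak subset of `{1, …, n}`, where `n` is the length of `u`,
the vector composition `I_{S,u}` exists, and the colouring word of `odd I_{S,u}` is `u`. -/
def Admissible {l : ℕ} (S : Finset ℕ) (u : List (Fin l)) : Prop :=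
  IsPeakSubset u.length S ∧ ∃ I : VComp l, IsPeakComp S u I ∧ I.odd.word = u

/-! ### Quasisymmetric functions of level `l`

The variable `x_j^{(i)}` is indexed by `(j, i) : ℕ × Fin l`; the first index starts from `0`. -/

/-- If `x ^ d = x_{j₁}^{i₁} ⋯ x_{jₘ}^{iₘ}` with `j₁ < ⋯ < jₘ` and nonzero columns `i₁, …, iₘ`, this
is the vector composition `(i₁, …, iₘ)`. -/
def cols {l : ℕ} (d : ℕ × Fin l →₀ ℕ) : VComp l :=
  ⟨((d.support.image Prod.fst).sort (· ≤ ·)).map fun j i => d (j, i), by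
    intro v hv h0
    obtain ⟨j, hj, rfl⟩ := List.mem_map.1 hv
    rw [Finset.mem_sort, Finset.mem_image] at hj
    obtain ⟨⟨j', i⟩, hji, rfl⟩ := hj
    exact (Finsupp.mem_support_iff.1 hji) (congrFun h0 i)⟩

/-- The space `QSym^(l)`: formal power series of finite degree in which the coefficients of
`x_{j₁}^{i₁} ⋯ x_{jₘ}^{iₘ}` for `j₁ < ⋯ < jₘ` depend only on the vector composition
`(i₁, …, iₘ)`. -/
def QSym (l : ℕ) : Submodule ℚ (MvPowerSeries (ℕ × Fin l) ℚ) where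
  carrier := {f | (∃ N : ℕ, ∀ d, MvPowerSeries.coeff d f ≠ 0 → d.degree ≤ N) ∧
    ∀ d d', cols d = cols d' → MvPowerSeries.coeff d f = MvPowerSeries.coeff d' f}
  zero_mem' := ⟨⟨0, by simp⟩, by simp⟩
  add_mem' := by
    rintro f g ⟨⟨N, hN⟩, hf⟩ ⟨⟨N', hN'⟩, hg⟩
    refine ⟨⟨max N N', fun d hd => ?_⟩, fun d d' h => by simp [hf d d' h, hg d d' h]⟩
    by_cases h : MvPowerSeries.coeff d f = 0
    · exact le_max_of_le_right (hN' d fun h' => hd (by simp [h, h']))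
    · exact le_max_of_le_left (hN d h)
  smul_mem' := by
    rintro c f ⟨⟨N, hN⟩, hf⟩
    exact ⟨⟨N, fun d hd => hN d fun h => hd (by simp [h])⟩, fun d d' h => by simp [hf d d' h]⟩

section basis

variable {l : ℕ}

lemma wt_pos {v : Fin l → ℕ} (hv : v ≠ 0) : 0 < wt v := by
  rcases Nat.eq_zero_or_pos (wt v) with h | h
  · exact absurd (funext fun i => by simpa using (Finset.sum_eq_zero_iff.1 h) i (by simp)) hv
  · exact h

lemma weight_cols (d : ℕ × Fin l →₀ ℕ) : (cols d).weight = d.degree := by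
  unfold VComp.weight cols
  rw [List.map_map, ← List.sum_toFinset _ (Finset.sort_nodup _ _), Finset.sort_toFinset]
  simp only [Function.comp_def, wt]
  rw [← Finset.sum_product', Finsupp.degree_apply]
  refine (Finset.sum_subset (fun p hp => ?_) fun p _ hp => by simpa using hp).symm
  simp only [Finset.mem_product, Finset.mem_univ, and_true]
  exact Finset.mem_image_of_mem _ hp

/-- The exponent of the monomial `x_1^{i₁} ⋯ x_m^{iₘ}`. -/
def stdExp (I : VComp l) : ℕ × Fin l →₀ ℕ :=
  Finsupp.onFinset (Finset.range I.len ×ˢ Finset.univ) (fun p => I.1.getD p.1 0 p.2) (by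
    intro p hp
    simp only [Finset.mem_product, Finset.mem_range, Finset.mem_univ, and_true]
    by_contra h
    exact hp (by rw [List.getD_eq_default _ _ (not_lt.1 h)]; rfl))

lemma cols_stdExp (I : VComp l) : cols (stdExp I) = I := by
  have h : (stdExp I).support.image Prod.fst = Finset.range I.len := by
    ext j
    simp only [Finset.mem_image, Finsupp.mem_support_iff, Prod.exists, Finset.mem_range,
      exists_and_right, exists_eq_right]
    constructor
    · rintro ⟨i, hi⟩
      by_contra hj
      exact hi (by
        simp only [stdExp, Finsupp.onFinset_apply]
        rw [List.getD_eq_default _ _ (not_lt.1 hj)]; rfl)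
    · intro hj
      obtain ⟨i, hi⟩ := Function.ne_iff.1 (I.2 _ (List.getElem_mem hj))
      refine ⟨i, ?_⟩
      simp only [stdExp, Finsupp.onFinset_apply]
      rw [List.getD_eq_getElem _ _ hj]
      exact hi
  apply Subtype.ext
  simp only [cols, h, Finset.sort_range]
  apply List.ext_getElem
  · simp [VComp.len]
  · intro j h1 h2
    funext i
    rw [List.getElem_map, List.getElem_range]
    show I.1.getD j 0 i = _
    rw [List.getD_eq_getElem _ _ h2]

lemma finite_weight_le (N : ℕ) : {I : VComp l | I.weight ≤ N}.Finite := by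
  have hfin : {v : Fin l → ℕ | wt v ≤ N}.Finite := by
    refine (Set.finite_Iic (fun _ : Fin l => N)).subset fun v hv i => ?_
    exact (Finset.single_le_sum (f := v) (fun _ _ => Nat.zero_le _) (Finset.mem_univ i)).trans hv
  have : Finite {v : Fin l → ℕ // wt v ≤ N} := hfin
  have h2 := (List.finite_length_le {v : Fin l → ℕ // wt v ≤ N} N).image (List.map Subtype.val)
  refine Set.Finite.of_finite_image (f := Subtype.val) (h2.subset ?_)
    Subtype.val_injective.injOn
  rintro _ ⟨I, hI, rfl⟩
  have hle : ∀ v ∈ I.1, wt v ≤ N := fun v hv =>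
    (List.single_le_sum (by simp) _ (List.mem_map_of_mem hv)).trans hI
  refine ⟨I.1.pmap Subtype.mk hle, ?_, by simp [List.map_pmap]⟩
  have hlen : I.1.length ≤ (I.1.map wt).sum := by
    have h := List.card_nsmul_le_sum (I.1.map wt) 1 (by
      intro x hx
      obtain ⟨v, hv, rfl⟩ := List.mem_map.1 hx
      exact wt_pos (I.2 v hv))
    simpa using h
  simpa using hlen.trans hI

lemma finite_coarsens (J : VComp l) : {I : VComp l | I.Coarsens J}.Finite := by
  refine (finite_weight_le J.weight).subset ?_
  rintro I ⟨P, hJ, hI⟩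
  show I.weight ≤ J.weight
  have hw : ∀ K : VComp l, wt K.total = (K.1.map wt).sum := fun K => by
    have hadd : ∀ L : List (Fin l → ℕ), wt L.sum = (L.map wt).sum := fun L => by
      induction L with
      | nil => simp [wt]
      | cons v L ih =>
        rw [List.sum_cons, List.map_cons, List.sum_cons, ← ih]
        simp [wt, Finset.sum_add_distrib]
    exact hadd K.1
  unfold VComp.weight
  rw [← hI, ← hJ, List.map_flatten, List.sum_flatten, List.map_map, List.map_map, List.map_map]
  exact le_of_eq (congrArg List.sum (List.map_congr_left fun K _ => hw K))

/-- The linear map sending a finitely supported function `g` on vector compositions to the series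
whose coefficient at `x ^ d` is `g (cols d)`. -/
def ofFinsupp (l : ℕ) : (VComp l →₀ ℚ) →ₗ[ℚ] QSym l where
  toFun g := ⟨fun d => g (cols d), by
    refine ⟨⟨g.support.sup VComp.weight, fun d hd => ?_⟩, fun d d' h => ?_⟩
    · rw [← weight_cols]
      exact Finset.le_sup (f := VComp.weight) (Finsupp.mem_support_iff.2 hd)
    · exact congrArg g h⟩
  map_add' _ _ := rfl
  map_smul' _ _ := rfl

lemma ofFinsupp_bijective (l : ℕ) : Function.Bijective (ofFinsupp l) := by
  constructor
  · intro g g' h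
    ext I
    have h' : g (cols (stdExp I)) = g' (cols (stdExp I)) :=
      congrFun (congrArg Subtype.val h) (stdExp I)
    rwa [cols_stdExp] at h'
  · rintro ⟨f, ⟨N, hN⟩, hf⟩
    refine ⟨Finsupp.ofSupportFinite (fun I => MvPowerSeries.coeff (stdExp I) f)
      ((finite_weight_le N).subset fun I hI => ?_), ?_⟩
    · have := hN _ hI
      rwa [← weight_cols, cols_stdExp] at this
    · apply Subtype.ext
      funext d
      exact hf _ _ (cols_stdExp _)

end basis

/-- The basis of `QSym^(l)` formed by the monomial quasisymmetric functions. -/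
def monoBasis (l : ℕ) : Module.Basis (VComp l) ℚ (QSym l) :=
  Module.Basis.ofRepr (LinearEquiv.ofBijective (ofFinsupp l) (ofFinsupp_bijective l)).symm

/-- The monomial quasisymmetric function
`M_I = ∑_{j₁ < ⋯ < jₘ} x_{j₁}^{i₁} ⋯ x_{jₘ}^{iₘ}`. -/
def M {l : ℕ} (I : VComp l) : QSym l := monoBasis l I

open Classical in
/-- `M_I` is the sum of all monomials whose sequence of columns is `I`. -/
lemma coeff_M {l : ℕ} (I : VComp l) (d : ℕ × Fin l →₀ ℕ) :
    MvPowerSeries.coeff d (M I : MvPowerSeries (ℕ × Fin l) ℚ) = if cols d = I then 1 else 0 := by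
  have : M I = ofFinsupp l (Finsupp.single I 1) := by
    simp [M, monoBasis, Module.Basis.coe_ofRepr]
  rw [this]
  show (Finsupp.single I (1 : ℚ)) (cols d) = _
  rw [Finsupp.single_apply]
  simp [eq_comm]

/-- The component of multidegree `n` of `QSym^(l)`. -/
def homog {l : ℕ} (n : Fin l → ℕ) : Submodule ℚ (QSym l) where
  carrier := {f | ∀ d, MvPowerSeries.coeff d (f : MvPowerSeries (ℕ × Fin l) ℚ) ≠ 0 →
    (cols d).total = n}
  zero_mem' := by simp
  add_mem' := by
    intro f g hf hg d hd
    by_cases h : MvPowerSeries.coeff d (f : MvPowerSeries (ℕ × Fin l) ℚ) = 0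
    · exact hg d fun h' => hd (by simp [h, h'])
    · exact hf d h
  smul_mem' := by
    intro c f hf d hd
    exact hf d fun h => hd (by simp [h])

/-! ### The coalgebra structure and the peak algebra -/

/-- The deconcatenation coproduct `Δ M_I = ∑_{I = JK} M_J ⊗ M_K`. -/
def deconcat (l : ℕ) : QSym l →ₗ[ℚ] QSym l ⊗[ℚ] QSym l :=
  (monoBasis l).constr ℚ fun I =>
    ∑ k ∈ Finset.range (I.len + 1), M (I.take k) ⊗ₜ[ℚ] M (I.drop k)

lemma deconcat_M {l : ℕ} (I : VComp l) : deconcat l (M I) =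
    ∑ k ∈ Finset.range (I.len + 1), M (I.take k) ⊗ₜ[ℚ] M (I.drop k) :=
  (monoBasis l).constr_basis ℚ _ I

/-- The projection onto the component of multidegree `0`. -/
def augment (l : ℕ) : QSym l →ₗ[ℚ] ℚ :=
  (monoBasis l).constr ℚ fun I => if I.len = 0 then 1 else 0

lemma augment_M {l : ℕ} (I : VComp l) : augment l (M I) = if I.len = 0 then 1 else 0 :=
  (monoBasis l).constr_basis ℚ _ I

lemma len_take {l : ℕ} (k : ℕ) (I : VComp l) : (I.take k).len = min k I.len := by
  simp [VComp.take, VComp.len]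

lemma len_drop {l : ℕ} (k : ℕ) (I : VComp l) : (I.drop k).len = I.len - k := by
  simp [VComp.drop, VComp.len]

lemma take_take {l : ℕ} (j k : ℕ) (I : VComp l) (h : j ≤ k) : (I.take k).take j = I.take j := by
  apply Subtype.ext
  simp [VComp.take, List.take_take, h]

lemma drop_drop {l : ℕ} (j k : ℕ) (I : VComp l) : (I.drop j).drop k = I.drop (j + k) := by
  apply Subtype.ext
  simp [VComp.drop, List.drop_drop]

lemma drop_take {l : ℕ} (j k : ℕ) (I : VComp l) :
    (I.take (j + k)).drop j = (I.drop j).take k := by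
  apply Subtype.ext
  simp [VComp.drop, VComp.take, List.drop_take]

lemma drop_zero {l : ℕ} (I : VComp l) : I.drop 0 = I := by
  apply Subtype.ext
  simp [VComp.drop]

lemma take_len {l : ℕ} (I : VComp l) : I.take I.len = I := by
  apply Subtype.ext
  simp [VComp.take, VComp.len]

instance instCoalgebraQSym (l : ℕ) : Coalgebra ℚ (QSym l) where
  comul := deconcat l
  counit := augment l
  coassoc := by
    refine (monoBasis l).ext fun I => ?_
    change TensorProduct.assoc ℚ _ _ _ ((deconcat l).rTensor _ (deconcat l (M I))) =
      (deconcat l).lTensor _ (deconcat l (M I))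
    simp only [deconcat_M, map_sum, LinearMap.rTensor_tmul, LinearMap.lTensor_tmul,
      TensorProduct.sum_tmul, TensorProduct.tmul_sum, TensorProduct.assoc_tmul]
    rw [Finset.sum_sigma', Finset.sum_sigma']
    refine Finset.sum_bij' (fun x _ => ⟨x.2, x.1 - x.2⟩) (fun y _ => ⟨y.1 + y.2, y.1⟩)
      ?_ ?_ ?_ ?_ ?_
    · rintro ⟨k, j⟩ h
      simp only [Finset.mem_sigma, Finset.mem_range, len_take, len_drop] at h ⊢
      omega
    · rintro ⟨j, i⟩ h
      simp only [Finset.mem_sigma, Finset.mem_range, len_take, len_drop] at h ⊢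
      omega
    · rintro ⟨k, j⟩ h
      simp only [Finset.mem_sigma, Finset.mem_range, len_take] at h
      have : j + (k - j) = k := by omega
      simp [this]
    · rintro ⟨j, i⟩ h
      simp
    · rintro ⟨k, j⟩ h
      simp only [Finset.mem_sigma, Finset.mem_range, len_take] at h
      obtain ⟨i, rfl⟩ : ∃ i, k = j + i := ⟨k - j, by omega⟩
      simp only [Nat.add_sub_cancel_left]
      rw [take_take _ _ _ (Nat.le_add_right j i), drop_take, drop_drop]
  rTensor_counit_comp_comul := by
    refine (monoBasis l).ext fun I => ?_
    change (augment l).rTensor _ (deconcat l (M I)) = 1 ⊗ₜ[ℚ] M I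
    rw [deconcat_M, map_sum, Finset.sum_eq_single 0]
    · simp [augment_M, len_take, drop_zero]
    · intro k hk hk0
      have h : (I.take k).len ≠ 0 := by
        rw [Finset.mem_range] at hk
        rw [len_take]
        omega
      simp [augment_M, h]
    · simp
  lTensor_counit_comp_comul := by
    refine (monoBasis l).ext fun I => ?_
    change (augment l).lTensor _ (deconcat l (M I)) = M I ⊗ₜ[ℚ] 1
    rw [deconcat_M, map_sum, Finset.sum_eq_single I.len]
    · simp [augment_M, len_drop, take_len]
    · intro k hk hk0
      have h : (I.drop k).len ≠ 0 := by
        rw [Finset.mem_range] at hk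
        rw [len_drop]
        omega
      simp [augment_M, h]
    · simp

/-- The universal character: `ζ(M_I) = 1` if `I` has at most one column, and `0` otherwise.
Equivalently, `ζ` is the evaluation at `x_1^{(i)} = 1` and `x_j^{(i)} = 0` for `j ≠ 1`. -/
def zeta (l : ℕ) : QSym l →ₗ[ℚ] ℚ :=
  (monoBasis l).constr ℚ fun I => if I.len ≤ 1 then 1 else 0

lemma zeta_M {l : ℕ} (I : VComp l) : zeta l (M I) = if I.len ≤ 1 then 1 else 0 :=
  (monoBasis l).constr_basis ℚ _ I

/-- The functional `M_I ↦ (-1)^{ℓ(I)}`. -/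
def signLen (l : ℕ) : QSym l →ₗ[ℚ] ℚ :=
  (monoBasis l).constr ℚ fun I => (-1) ^ I.len

lemma signLen_M {l : ℕ} (I : VComp l) : signLen l (M I) = (-1) ^ I.len :=
  (monoBasis l).constr_basis ℚ _ I

lemma conv_eq_one {l : ℕ} (φ ψ : QSym l →ₗ[ℚ] ℚ)
    (h : ∀ I : VComp l, ∑ k ∈ Finset.range (I.len + 1), φ (M (I.take k)) * ψ (M (I.drop k)) =
      if I.len = 0 then 1 else 0) :
    WithConv.toConv φ * WithConv.toConv ψ = 1 := by
  apply WithConv.ext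
  refine (monoBasis l).ext fun I => ?_
  change LinearMap.mul' ℚ ℚ (TensorProduct.map φ ψ (deconcat l (M I))) =
    Algebra.linearMap ℚ ℚ (augment l (M I))
  rw [deconcat_M, augment_M, map_sum, map_sum]
  simpa using h I

/-- The universal character as a unit for the convolution product of linear functionals. -/
def zetaUnit (l : ℕ) : (WithConv (QSym l →ₗ[ℚ] ℚ))ˣ where
  val := WithConv.toConv (zeta l)
  inv := WithConv.toConv (signLen l)
  val_inv := by
    refine conv_eq_one _ _ fun I => ?_
    simp only [zeta_M, signLen_M, len_take, len_drop]
    rcases Nat.eq_zero_or_pos I.len with h | h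
    · simp [h]
    · obtain ⟨m, hm⟩ : ∃ m, I.len = m + 1 := ⟨I.len - 1, by omega⟩
      rw [hm, Finset.sum_range_succ', Finset.sum_range_succ', Finset.sum_eq_zero]
      · simp [pow_succ]
      · intro k hk
        rw [Finset.mem_range] at hk
        rw [if_neg (by omega), zero_mul]
  inv_val := by
    refine conv_eq_one _ _ fun I => ?_
    simp only [zeta_M, signLen_M, len_take, len_drop]
    rcases Nat.eq_zero_or_pos I.len with h | h
    · simp [h]
    · obtain ⟨m, hm⟩ : ∃ m, I.len = m + 1 := ⟨I.len - 1, by omega⟩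
      rw [hm, Finset.sum_range_succ, Finset.sum_range_succ, Finset.sum_eq_zero]
      · simp [pow_succ]
      · intro k hk
        rw [Finset.mem_range] at hk
        rw [if_neg (by omega), mul_zero]

/-- The convolution inverse of the universal character. -/
def zetaInv (l : ℕ) : QSym l →ₗ[ℚ] ℚ := (zetaUnit l)⁻¹.val.ofConv

/-- The functional `h ↦ (-1)^{|n|} φ(h)` for `h` of multidegree `n`. -/
def bar {l : ℕ} (φ : QSym l →ₗ[ℚ] ℚ) : QSym l →ₗ[ℚ] ℚ :=
  (monoBasis l).constr ℚ fun I => (-1) ^ I.weight * φ (M I)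

/-- Graded subcoalgebras of `QSym^(l)`: subspaces spanned by their homogeneous elements, with
`Δ(C) ⊆ C ⊗ C`. -/
structure IsGradedSubcoalgebra {l : ℕ} (C : Submodule ℚ (QSym l)) : Prop where
  graded : C ≤ ⨆ n : Fin l → ℕ, C ⊓ homog n
  comul_mem : ∀ h ∈ C, (CoalgebraStruct.comul h : QSym l ⊗[ℚ] QSym l) ∈
    Submodule.map₂ (TensorProduct.mk ℚ (QSym l) (QSym l)) C C

/-- The sum of all components whose multidegree is at most `k`. -/
def upTo {l : ℕ} (k : Fin l → ℕ∞) : Submodule ℚ (QSym l) :=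
  ⨆ n : {n : Fin l → ℕ // ∀ i, (n i : ℕ∞) ≤ k i}, homog n.1

/-- The condition defining `S_k(φ, ψ)`: a graded subcoalgebra on which `φ` and `ψ` agree up to
multidegree `k`. -/
def AgreeOn {l : ℕ} (k : Fin l → ℕ∞) (φ ψ : QSym l →ₗ[ℚ] ℚ) (C : Submodule ℚ (QSym l)) : Prop :=
  IsGradedSubcoalgebra C ∧ ∀ h ∈ C ⊓ upTo k, φ h = ψ h

/-- `S_k(φ, ψ)`: the largest graded subcoalgebra on which `φ` and `ψ` agree up to
multidegree `k`. -/
def agreeSub {l : ℕ} (k : Fin l → ℕ∞) (φ ψ : QSym l →ₗ[ℚ] ℚ) : Submodule ℚ (QSym l) :=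
  sSup {C | AgreeOn k φ ψ C}

open Classical in
/-- The projection of `QSym^(l)` onto `upTo k` that annihilates the other components. -/
def projUpTo {l : ℕ} (k : Fin l → ℕ∞) : QSym l →ₗ[ℚ] QSym l :=
  (monoBasis l).constr ℚ fun I => if ∀ i, (I.total i : ℕ∞) ≤ k i then M I else 0

open Classical in
lemma projUpTo_homog {l : ℕ} (k : Fin l → ℕ∞) (n : Fin l → ℕ) (h : QSym l) (hh : h ∈ homog n) :
    projUpTo k h = if ∀ i, (n i : ℕ∞) ≤ k i then h else 0 := by
  have hrepr : ∀ I, (monoBasis l).repr h I ≠ 0 → I.total = n := by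
    intro I hI
    obtain ⟨g, rfl⟩ := (ofFinsupp_bijective l).2 h
    have hg : (monoBasis l).repr (ofFinsupp l g) = g :=
      (LinearEquiv.ofBijective (ofFinsupp l) (ofFinsupp_bijective l)).symm_apply_apply g
    rw [hg] at hI
    have := hh (stdExp I) (by
      show g (cols (stdExp I)) ≠ 0
      rwa [cols_stdExp])
    rwa [cols_stdExp] at this
  have hsum : h = ((monoBasis l).repr h).sum fun I c => c • M I :=
    ((monoBasis l).linearCombination_repr h).symm
  rw [projUpTo, Module.Basis.constr_apply]
  split_ifs with hn
  · conv_rhs => rw [hsum]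
    refine Finsupp.sum_congr fun I hI => ?_
    rw [hrepr I (Finsupp.mem_support_iff.1 hI), if_pos hn]
  · refine Finset.sum_eq_zero fun I hI => ?_
    dsimp only
    rw [hrepr I (Finsupp.mem_support_iff.1 hI), if_neg hn, smul_zero]

/-- `agreeSub k φ ψ` is indeed the largest such graded subcoalgebra. -/
lemma isGreatest_agreeSub {l : ℕ} (k : Fin l → ℕ∞) (φ ψ : QSym l →ₗ[ℚ] ℚ) :
    IsGreatest {C | AgreeOn k φ ψ C} (agreeSub k φ ψ) := by
  refine ⟨⟨⟨sSup_le fun C hC => ?_, fun h hh => ?_⟩, fun h hh => ?_⟩, fun C hC => le_sSup hC⟩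
  · exact hC.1.graded.trans (iSup_mono fun n => inf_le_inf_right _ (le_sSup hC))
  · have : agreeSub k φ ψ ≤ (Submodule.map₂ (TensorProduct.mk ℚ (QSym l) (QSym l))
        (agreeSub k φ ψ) (agreeSub k φ ψ)).comap CoalgebraStruct.comul :=
      sSup_le fun C hC x hx =>
        Submodule.map₂_le_map₂ (le_sSup hC) (le_sSup hC) (hC.1.comul_mem x hx)
    exact this hh
  · have h1 : agreeSub k φ ψ ≤ LinearMap.ker ((φ - ψ) ∘ₗ projUpTo k) := by
      refine sSup_le fun C hC => hC.1.graded.trans (iSup_le fun n x hx => ?_)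
      rw [LinearMap.mem_ker, LinearMap.comp_apply, projUpTo_homog k n x hx.2]
      split_ifs with hn
      · have hx' : x ∈ upTo k := Submodule.mem_iSup_of_mem
          (⟨n, hn⟩ : {n : Fin l → ℕ // ∀ i, (n i : ℕ∞) ≤ k i}) hx.2
        rw [LinearMap.sub_apply, hC.2 x ⟨hx.1, hx'⟩, sub_self]
      · simp
    have h2 : upTo k ≤ LinearMap.ker (projUpTo k - LinearMap.id) := by
      refine iSup_le fun n x hx => ?_
      rw [LinearMap.mem_ker, LinearMap.sub_apply, projUpTo_homog k n.1 x hx, if_pos n.2]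
      simp
    have h3 : projUpTo k h = h := sub_eq_zero.1 (h2 hh.2)
    have h4 := h1 hh.1
    rw [LinearMap.mem_ker, LinearMap.comp_apply, h3] at h4
    exact sub_eq_zero.1 h4

/-- The `k`-odd subalgebra of `QSym^(l)`. -/
def oddSub {l : ℕ} (k : Fin l → ℕ∞) : Submodule ℚ (QSym l) :=
  agreeSub k (bar (zeta l)) (zetaInv l)

/-- The peak algebra of level `l`. -/
def peakAlgebra (l : ℕ) : Submodule ℚ (QSym l) := oddSub fun _ => ⊤

/-- `η_I = ∑_J 2^{ℓ(J)} M_J`, over all `J` such that `I` is a refinement of `J`. -/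
def eta {l : ℕ} (I : VComp l) : QSym l :=
  ∑ J ∈ (finite_coarsens I).toFinset, (2 : ℚ) ^ J.len • M J

open Classical in
/-- The peak function `θ_{S,u} = ∑_J 2^{ℓ(J)} M_J`, over all `J` refined by
`(e_{u₁}, …, e_{uₙ})` such that `S ⊆ D(J) ∪ (D(J) + 1)`. -/
def theta {l : ℕ} (S : Finset ℕ) (u : List (Fin l)) : QSym l :=
  ∑ J ∈ (finite_coarsens (VComp.coord u)).toFinset with
    S ⊆ J.dset ∪ J.dset.image (· + 1), (2 : ℚ) ^ J.len • M J

end LevelQSym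

end

open LevelQSym

/-! Everything rests on one comparison of sets. Fix a word `u` of length `n`. A coarsening of `E_u`
is determined by its descent set, and among such coarsenings refinement is inclusion of descent sets
(`coarsens_iff_dset_subset`). In a composition with columns of weight `1` and `2` that ends in
weight `1`, a position `d` is the end of an odd column exactly when neither `d` nor `d + 1` is a
peak (`IsPeakList.ends_odd_iff`). Hence `J` coarsens `odd I_{T,u}` iff `J` coarsens `E_u` and `T` is
disjoint from `X = D(J) ∪ (D(J) + 1)`. So `η` of `odd I_{T,u}` sums over the `J` with `T ∩ X = ∅`,
while `θ_{S,u}` sums over the `J` with `S ⊆ X`. Inclusion-exclusion over the subsets of a finite set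
turns each condition into the other with the same signs, which gives both formulas.

The formulas need `(T, u)` to be admissible for all `T ⊆ S` (`Admissible.mono`): splitting weight-2
columns produces `I_{T,u}`, and refining `odd I_{S,u}` inside `E_u` does not disturb its colouring
word. Moreover `(S, u) ↦ odd I_{S,u}` is a bijection from admissible pairs to odd compositions, with
inverse `I ↦ (Peak(tilde I), c(I))` (`admissibleEquiv`).

It remains to see that the `η_I` with `I` odd form a basis of the peak algebra
(`peakAlgebra_eq_oddSpan`). Independence is triangularity in the length. The `η_I` deconcatenate
like the `M_I`; for nonempty `I`, `ζ` takes the value `2` and its inverse the value `2 (-1)^{ℓ(I)}`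
on `η_I`, so the odd ones lie in the peak algebra. Conversely, a homogeneous element without
coefficients at odd compositions vanishes (`eq_zero_of_repr_odd`): contracting its coproduct around
an even column `v` isolates a multiple of `M_v` in the peak algebra, where the two characters have
opposite signs. Since the transition from `η` to `θ` is an involution, the `θ` form a basis too. -/

namespace LevelQSym

variable {l : ℕ}

/-! ### Weights and colouring words -/

lemma wt_zero : wt (0 : Fin l → ℕ) = 0 := by simp [wt]

lemma wt_add (v w : Fin l → ℕ) : wt (v + w) = wt v + wt w := by
  simp [wt, Finset.sum_add_distrib]

lemma wt_sum (L : List (Fin l → ℕ)) : wt L.sum = (L.map wt).sum := by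
  induction L with
  | nil => simp [wt_zero]
  | cons v L ih => simp [wt_add, ih]

lemma wt_single (a : Fin l) : wt (Pi.single a 1 : Fin l → ℕ) = 1 := by simp [wt]

lemma VComp.weight_eq (I : VComp l) : I.weight = wt I.total := (wt_sum I.1).symm

lemma weight_pos {L : List (Fin l → ℕ)} (hL : ∀ v ∈ L, v ≠ 0) (hne : L ≠ []) :
    0 < (L.map wt).sum := by
  cases L with
  | nil => exact absurd rfl hne
  | cons v L =>
    have := wt_pos (hL v (by simp))
    simp only [List.map_cons, List.sum_cons]
    omega

lemma count_colWord (v : Fin l → ℕ) (a : Fin l) : (VComp.colWord v).count a = v a := by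
  unfold VComp.colWord
  rw [List.count_flatMap]
  have : (List.count a ∘ fun i => List.replicate (v i) i) = fun i => if i = a then v i else 0 := by
    funext i
    simp [List.count_replicate]
  rw [this, ← Fin.sum_univ_def]
  simp

lemma colWord_injective : Function.Injective (VComp.colWord (l := l)) := fun v w h => by
  funext a
  rw [← count_colWord v, h, count_colWord]

lemma length_colWord (v : Fin l → ℕ) : (VComp.colWord v).length = wt v := by
  unfold VComp.colWord wt
  rw [List.length_flatMap, Fin.sum_univ_def]
  simp

lemma pairwise_colWord (v : Fin l → ℕ) : (VComp.colWord v).Pairwise (· ≤ ·) := by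
  unfold VComp.colWord
  rw [List.pairwise_flatMap]
  refine ⟨fun a _ => List.pairwise_replicate.2 (Or.inr le_rfl), ?_⟩
  refine (List.pairwise_lt_finRange l).imp fun {a b} hab x hx y hy => ?_
  rw [List.eq_of_mem_replicate hx, List.eq_of_mem_replicate hy]
  exact hab.le

lemma sum_single_apply (w : List (Fin l)) (a : Fin l) :
    (w.map fun i => (Pi.single i 1 : Fin l → ℕ)).sum a = w.count a := by
  induction w with
  | nil => simp
  | cons b w ih =>
    simp only [List.map_cons, List.sum_cons, Pi.add_apply, ih, List.count_cons, Pi.single_apply,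
      beq_iff_eq, eq_comm (a := a)]
    rw [add_comm]

lemma sum_colWord (v : Fin l → ℕ) :
    ((VComp.colWord v).map fun i => (Pi.single i 1 : Fin l → ℕ)).sum = v := by
  funext a
  rw [sum_single_apply, count_colWord]

lemma colWord_sum {w : List (Fin l)} (hw : w.Pairwise (· ≤ ·)) :
    VComp.colWord (w.map fun i => (Pi.single i 1 : Fin l → ℕ)).sum = w := by
  refine List.Perm.eq_of_pairwise (fun a b _ _ => le_antisymm) (pairwise_colWord _) hw ?_
  rw [List.perm_iff_count]
  intro a
  rw [count_colWord, sum_single_apply]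

lemma colWord_single (a : Fin l) : VComp.colWord (Pi.single a 1) = [a] := by
  simpa using colWord_sum (w := [a]) (by simp)

lemma colWord_pair {a b : Fin l} (h : a ≤ b) :
    VComp.colWord (Pi.single a 1 + Pi.single b 1) = [a, b] := by
  simpa using colWord_sum (w := [a, b]) (by simpa using h)

lemma length_word (L : List (Fin l → ℕ)) :
    (L.flatMap VComp.colWord).length = (L.map wt).sum := by
  rw [List.length_flatMap]
  simp [length_colWord]

lemma VComp.length_word (I : VComp l) : I.word.length = I.weight := LevelQSym.length_word I.1

/-! ### Refinement -/

/-- Every prefix sum of `J` is a prefix sum of `I`. -/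
def PrefixSumsLE (J I : List (Fin l → ℕ)) : Prop :=
  ∀ A, A <+: J → ∃ B, B <+: I ∧ B.sum = A.sum

lemma prefixSumsLE_of_parts (P : List (VComp l)) :
    PrefixSumsLE (P.map VComp.total) (P.map Subtype.val).flatten := by
  intro A hA
  obtain ⟨Q, hQ, rfl⟩ := List.prefix_map_iff.1 hA
  obtain ⟨R, rfl⟩ := hQ
  refine ⟨(Q.map Subtype.val).flatten, by simp, ?_⟩
  rw [List.sum_flatten, List.map_map]
  rfl

/-- The parts are cut off greedily: the first column of `J` is the sum of some prefix of `I`, and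
the prefix-sum condition survives the removal of both. -/
lemma exists_parts (J I : List (Fin l → ℕ)) (hI : ∀ v ∈ I, v ≠ 0)
    (hs : J.sum = I.sum) (hp : PrefixSumsLE J I) :
    ∃ P : List (VComp l), (P.map Subtype.val).flatten = I ∧ P.map VComp.total = J := by
  induction J generalizing I with
  | nil =>
    refine ⟨[], ?_, rfl⟩
    by_contra h
    have := weight_pos hI (fun h' => h (by simp [h']))
    rw [← wt_sum, ← hs] at this
    simp [wt_zero] at this
  | cons v J ih =>
    obtain ⟨A, ⟨I', rfl⟩, hA⟩ := hp [v] (by simp)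
    have hA' : A.sum = v := by simpa using hA
    obtain ⟨P, hP, rfl⟩ := ih I' (fun w hw => hI w (by simp [hw]))
      (by
        rw [List.sum_cons, List.sum_append, hA'] at hs
        exact add_left_cancel hs)
      (by
        intro B hB
        obtain ⟨C, hC, hCs⟩ := hp (v :: B) (by simpa using hB)
        rw [List.sum_cons] at hCs
        -- If `C` is contained in `A`, its sum is at most `v` in every coordinate, but it equals `v
        -- + B.sum`; so `B.sum = 0` and the empty prefix serves.
        rcases List.prefix_or_prefix_of_prefix hC (List.prefix_append A I') with h | h
        · obtain ⟨D, rfl⟩ := h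
          refine ⟨[], by simp, ?_⟩
          rw [List.sum_append] at hA'
          have h0 : C.sum + (D.sum + B.sum) = C.sum + 0 := by
            rw [← add_assoc, hA', ← hCs, add_zero]
          have h1 := add_left_cancel h0
          funext i
          have := congrFun h1 i
          simp only [Pi.add_apply, Pi.zero_apply] at this
          simp only [List.sum_nil, Pi.zero_apply]
          omega
        · obtain ⟨D, rfl⟩ := h
          refine ⟨D, (List.prefix_append_right_inj A).1 hC, ?_⟩
          rw [List.sum_append, hA'] at hCs
          exact add_left_cancel hCs)
    exact ⟨⟨A, fun w hw => hI w (by simp [hw])⟩ :: P, by rw [List.map_cons, List.flatten_cons, hP],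
      by simp [VComp.total, hA']⟩

/-- In terms of prefix sums, transitivity and the comparison with descent sets need no manipulation
of factorizations. -/
lemma coarsens_iff {J I : VComp l} :
    J.Coarsens I ↔ J.total = I.total ∧ PrefixSumsLE J.1 I.1 := by
  constructor
  · rintro ⟨P, hI, hJ⟩
    refine ⟨?_, hJ ▸ hI ▸ prefixSumsLE_of_parts P⟩
    unfold VComp.total
    rw [← hI, ← hJ, List.sum_flatten, List.map_map]
    rfl
  · rintro ⟨hs, hp⟩
    exact exists_parts J.1 I.1 I.2 hs hp

lemma VComp.Coarsens.total_eq {J I : VComp l} (h : J.Coarsens I) : J.total = I.total :=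
  (coarsens_iff.1 h).1

lemma VComp.Coarsens.weight_eq {J I : VComp l} (h : J.Coarsens I) : J.weight = I.weight := by
  rw [J.weight_eq, I.weight_eq, h.total_eq]

lemma VComp.Coarsens.refl (I : VComp l) : I.Coarsens I :=
  coarsens_iff.2 ⟨rfl, fun A hA => ⟨A, hA, rfl⟩⟩

lemma VComp.Coarsens.trans {K J I : VComp l} (h : K.Coarsens J) (h' : J.Coarsens I) :
    K.Coarsens I := by
  rw [coarsens_iff] at *
  refine ⟨h.1.trans h'.1, fun A hA => ?_⟩
  obtain ⟨B, hB, hBA⟩ := h.2 A hA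
  obtain ⟨C, hC, hCB⟩ := h'.2 B hB
  exact ⟨C, hC, hCB.trans hBA⟩

/-- Nonzero columns make the weight strictly increasing along prefixes. -/
lemma prefix_eq_of_weight_eq {L A B : List (Fin l → ℕ)} (hL : ∀ v ∈ L, v ≠ 0) (hA : A <+: L)
    (hB : B <+: L) (h : (A.map wt).sum = (B.map wt).sum) : A = B := by
  wlog hAB : A <+: B generalizing A B
  · exact (this hB hA h.symm ((List.prefix_or_prefix_of_prefix hA hB).resolve_left hAB)).symm
  obtain ⟨C, rfl⟩ := hAB
  by_cases hC : C = []
  · simp [hC]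
  · have := weight_pos (L := C) (fun v hv => hL v (hB.subset (by simp [hv]))) hC
    simp at h
    omega

/-! ### Positions of column ends -/

/-- `ends p L d`: some prefix of `L` of weight `d` ends with a column satisfying `p`. -/
def ends (p : (Fin l → ℕ) → Prop) : List (Fin l → ℕ) → ℕ → Prop
  | [], _ => False
  | v :: L, d => (p v ∧ d = wt v) ∨ ∃ e, ends p L e ∧ d = wt v + e

lemma ends_true_iff (L : List (Fin l → ℕ)) (d : ℕ) :
    ends (fun _ => True) L d ↔ ∃ A, A ≠ [] ∧ A <+: L ∧ (A.map wt).sum = d := by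
  induction L generalizing d with
  | nil => simp [ends]
  | cons v L ih =>
    simp only [ends, true_and, ih]
    constructor
    · rintro (rfl | ⟨e, ⟨A, -, hA, rfl⟩, rfl⟩)
      · exact ⟨[v], by simp, by simp, by simp⟩
      · exact ⟨v :: A, by simp, by simpa using hA, by simp⟩
    · rintro ⟨A, hne, hA, rfl⟩
      obtain ⟨w, A, rfl⟩ := List.exists_cons_of_ne_nil hne
      obtain ⟨rfl, hA'⟩ := List.cons_prefix_cons.1 hA
      by_cases h : A = []
      · left; simp [h]
      · exact Or.inr ⟨_, ⟨A, h, hA', rfl⟩, by simp⟩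

/-- The bound excludes the end of the last column, which `ends` counts and a descent set omits. -/
lemma mem_dset {I : VComp l} {d : ℕ} :
    d ∈ I.dset ↔ d < I.weight ∧ ends (fun _ => True) I.1 d := by
  rw [ends_true_iff]
  simp only [VComp.dset, Finset.mem_image, Finset.mem_Ico]
  constructor
  · rintro ⟨k, ⟨hk1, hk2⟩, rfl⟩
    have hk2' : k < I.1.length := hk2
    refine ⟨?_, I.1.take k, ?_, List.take_prefix _ _, rfl⟩
    · have := weight_pos (L := I.1.drop k) (fun v hv => I.2 v (List.mem_of_mem_drop hv))
        (by simpa using hk2')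
      have h2 : I.weight = ((I.1.take k ++ I.1.drop k).map wt).sum := by
        rw [List.take_append_drop]; rfl
      rw [h2, List.map_append, List.sum_append]
      change ((I.1.take k).map wt).sum < _
      omega
    · intro h
      have := congrArg List.length h
      rw [List.length_take, List.length_nil] at this
      omega
  · rintro ⟨hd, A, hne, hA, rfl⟩
    have hA' := List.prefix_iff_eq_take.1 hA
    refine ⟨A.length, ⟨List.length_pos_of_ne_nil hne, ?_⟩, ?_⟩
    · rcases hA.length_le.lt_or_eq with h | h
      · exact h
      · rw [hA.eq_of_length h] at hd
        exact absurd hd (lt_irrefl _)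
    · change ((I.1.take A.length).map wt).sum = _
      rw [← hA']

lemma ends_le {p : (Fin l → ℕ) → Prop} {L : List (Fin l → ℕ)} {d : ℕ} (h : ends p L d) :
    d ≤ (L.map wt).sum := by
  induction L generalizing d with
  | nil => exact h.elim
  | cons v L ih =>
    rw [List.map_cons, List.sum_cons]
    rcases h with ⟨-, rfl⟩ | ⟨e, he, rfl⟩
    · omega
    · have := ih he; omega

lemma ends_pos {p : (Fin l → ℕ) → Prop} {L : List (Fin l → ℕ)} {d : ℕ} (hL : ∀ v ∈ L, v ≠ 0)
    (h : ends p L d) : 0 < d := by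
  cases L with
  | nil => exact h.elim
  | cons v L =>
    have := wt_pos (hL v (by simp))
    rcases h with ⟨-, rfl⟩ | ⟨e, he, rfl⟩ <;> omega

lemma dset_subset (I : VComp l) : I.dset ⊆ Finset.Ico 1 I.weight := fun d hd => by
  obtain ⟨h1, h2⟩ := mem_dset.1 hd
  exact Finset.mem_Ico.2 ⟨ends_pos I.2 h2, h1⟩

lemma VComp.Coarsens.dset_subset {J I : VComp l} (h : J.Coarsens I) : J.dset ⊆ I.dset := by
  intro d hd
  have h0 := (Finset.mem_Ico.1 (LevelQSym.dset_subset J hd)).1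
  obtain ⟨h1, h2⟩ := mem_dset.1 hd
  refine mem_dset.2 ⟨h.weight_eq ▸ h1, ?_⟩
  obtain ⟨A, hne, hA, hAd⟩ := (ends_true_iff _ _).1 h2
  obtain ⟨B, hB, hBA⟩ := (coarsens_iff.1 h).2 A hA
  have hw : (B.map wt).sum = d := by rw [← wt_sum, hBA, wt_sum, hAd]
  refine (ends_true_iff _ _).2 ⟨B, ?_, hB, hw⟩
  rintro rfl
  simp at hw
  omega

/-- Descent sets see only weights; the common refinement `E` recovers the prefix sums, because a
prefix of `E` is determined by its weight. -/
lemma coarsens_iff_dset_subset {J I E : VComp l} (hJ : J.Coarsens E) (hI : I.Coarsens E) :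
    J.Coarsens I ↔ J.dset ⊆ I.dset := by
  refine ⟨fun h => h.dset_subset, fun h => coarsens_iff.2 ⟨hJ.total_eq.trans hI.total_eq.symm, ?_⟩⟩
  intro A hA
  by_cases hne : A = []
  · exact ⟨[], by simp, by simp [hne]⟩
  have hAe := (ends_true_iff _ _).2 ⟨A, hne, hA, rfl⟩
  rcases (ends_le hAe).lt_or_eq with hlt | heq
  · obtain ⟨-, hd⟩ := mem_dset.1 (h (mem_dset.2 ⟨hlt, hAe⟩))
    obtain ⟨B, -, hB, hBw⟩ := (ends_true_iff _ _).1 hd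
    obtain ⟨A', hA', hAs⟩ := (coarsens_iff.1 hJ).2 A hA
    obtain ⟨B', hB', hBs⟩ := (coarsens_iff.1 hI).2 B hB
    refine ⟨B, hB, ?_⟩
    rw [← hAs, ← hBs, prefix_eq_of_weight_eq E.2 hA' hB']
    rw [← wt_sum, ← wt_sum, hAs, hBs, wt_sum, wt_sum, hBw]
  · rw [prefix_eq_of_weight_eq J.2 hA List.prefix_rfl heq]
    exact ⟨I.1, List.prefix_rfl, hI.total_eq.trans hJ.total_eq.symm⟩

lemma coarsens_append {J₁ J₂ I₁ I₂ J I : VComp l} (h₁ : J₁.Coarsens I₁) (h₂ : J₂.Coarsens I₂)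
    (hJ : J.1 = J₁.1 ++ J₂.1) (hI : I.1 = I₁.1 ++ I₂.1) : J.Coarsens I := by
  obtain ⟨P, hP, hP'⟩ := h₁
  obtain ⟨Q, hQ, hQ'⟩ := h₂
  exact ⟨P ++ Q, by rw [List.map_append, List.flatten_append, hP, hQ, hI],
    by rw [List.map_append, hP', hQ', hJ]⟩

lemma coarsens_of_append {J₁ J₂ J I : VComp l} (h : J.Coarsens I) (hJ : J.1 = J₁.1 ++ J₂.1) :
    ∃ I₁ I₂ : VComp l, I.1 = I₁.1 ++ I₂.1 ∧ J₁.Coarsens I₁ ∧ J₂.Coarsens I₂ := by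
  obtain ⟨P, hP, hP'⟩ := h
  rw [hJ] at hP'
  obtain ⟨Q, R, rfl, hQ, hR⟩ := List.map_eq_append_iff.1 hP'
  have hm : ∀ v ∈ (Q.map Subtype.val).flatten ++ (R.map Subtype.val).flatten, v ≠ 0 := by
    rw [← List.flatten_append, ← List.map_append, hP]
    exact I.2
  exact ⟨⟨(Q.map Subtype.val).flatten, fun v hv => hm v (List.mem_append_left _ hv)⟩,
    ⟨(R.map Subtype.val).flatten, fun v hv => hm v (List.mem_append_right _ hv)⟩,
    by simp [← hP], ⟨Q, rfl, hQ⟩, ⟨R, rfl, hR⟩⟩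

lemma length_flatten_parts (P : List (VComp l)) (hP : ∀ Q ∈ P, Q.1 ≠ []) :
    P.length ≤ (P.map Subtype.val).flatten.length ∧
      ((P.map Subtype.val).flatten.length ≤ P.length →
        P.map VComp.total = (P.map Subtype.val).flatten) := by
  induction P with
  | nil => simp
  | cons Q P ih =>
    obtain ⟨h1, h2⟩ := ih fun R hR => hP R (by simp [hR])
    have hQ := List.length_pos_of_ne_nil (hP Q (by simp))
    rw [List.map_cons, List.map_cons, List.flatten_cons, List.length_append, List.length_cons]
    refine ⟨by omega, fun h => ?_⟩
    obtain ⟨v, hv⟩ := List.length_eq_one_iff.1 (show Q.1.length = 1 by omega)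
    rw [h2 (by omega), hv]
    simp [VComp.total, hv]

lemma parts_ne_nil {J : VComp l} {P : List (VComp l)} (hP : P.map VComp.total = J.1) :
    ∀ Q ∈ P, Q.1 ≠ [] := fun Q hQ h =>
  J.2 Q.total (hP ▸ List.mem_map_of_mem hQ) (by simp [VComp.total, h])

/-- The parts are nonempty, so equal lengths force each part to be a single column. This is the
source of all triangularity arguments below. -/
lemma VComp.Coarsens.eq_of_len_le {J I : VComp l} (h : J.Coarsens I) (hl : I.len ≤ J.len) :
    J = I := by
  obtain ⟨P, hP, hP'⟩ := h
  unfold VComp.len at hl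
  rw [← hP, ← hP', List.length_map] at hl
  exact Subtype.ext (by rw [← hP, ← hP', (length_flatten_parts P (parts_ne_nil hP')).2 hl])

/-! ### Odd coarsenings and peak sets -/

lemma ends_oddAux (L : List (Fin l → ℕ)) (acc : Fin l → ℕ) (d : ℕ) :
    ends (fun _ => True) (VComp.oddAux acc L) d ↔
      ∃ e, ends (fun v => Odd (wt v)) L e ∧ d = wt acc + e := by
  induction L generalizing acc d with
  | nil => simp [VComp.oddAux, ends]
  | cons v L ih =>
    unfold VComp.oddAux
    split_ifs with h
    · simp only [ends, ih, wt_add, wt_zero, h, true_and]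
      constructor
      · rintro (rfl | ⟨_, ⟨e, he, rfl⟩, rfl⟩)
        · exact ⟨_, Or.inl rfl, rfl⟩
        · exact ⟨_, Or.inr ⟨e, he, rfl⟩, by omega⟩
      · rintro ⟨_, rfl | ⟨e, he, rfl⟩, rfl⟩
        · exact Or.inl rfl
        · exact Or.inr ⟨e, ⟨e, he, by omega⟩, by omega⟩
    · simp only [ends, ih, wt_add, h, false_and, false_or]
      constructor
      · rintro ⟨e, he, rfl⟩
        exact ⟨_, ⟨e, he, rfl⟩, by omega⟩
      · rintro ⟨_, ⟨e, he, rfl⟩, rfl⟩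
        exact ⟨e, he, by omega⟩

/-- The second alternative is the end of the whole list, where `peakAux` outputs a remainder only if
it is nonzero. -/
lemma ends_peakAux (L : List (Fin l → ℕ)) (acc : Fin l → ℕ) (d : ℕ) :
    ends (fun _ => True) (VComp.peakAux acc L) d ↔
      (∃ e, ends (fun v => wt v ≠ 1) L e ∧ d = wt acc + e) ∨
        (0 < d ∧ d = wt acc + (L.map wt).sum) := by
  induction L generalizing acc d with
  | nil =>
    unfold VComp.peakAux
    split_ifs with h
    · simp [ends, h, wt_zero]; omega
    · have := wt_pos h
      simp [ends]; omega
  | cons v L ih =>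
    unfold VComp.peakAux
    rw [List.map_cons, List.sum_cons]
    split_ifs with h
    · simp only [ends, ih, wt_add, h, not_true, ne_eq, false_and, false_or]
      refine or_congr ⟨?_, ?_⟩ (by rw [add_assoc])
      · rintro ⟨e, he, rfl⟩
        exact ⟨_, ⟨e, he, rfl⟩, by omega⟩
      · rintro ⟨_, ⟨e, he, rfl⟩, rfl⟩
        exact ⟨e, he, by omega⟩
    · simp only [ends, ih, wt_add, wt_zero, true_and]
      constructor
      · rintro (rfl | ⟨_, ⟨e, he, rfl⟩ | ⟨h0, rfl⟩, rfl⟩)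
        · exact Or.inl ⟨_, Or.inl ⟨h, rfl⟩, rfl⟩
        · exact Or.inl ⟨_, Or.inr ⟨e, he, rfl⟩, by omega⟩
        · exact Or.inr ⟨by omega, by omega⟩
      · rintro (⟨_, ⟨-, rfl⟩ | ⟨e, he, rfl⟩, rfl⟩ | ⟨h0, rfl⟩)
        · exact Or.inl rfl
        · exact Or.inr ⟨e, Or.inl ⟨e, he, by omega⟩, by omega⟩
        · rcases Nat.eq_zero_or_pos (L.map wt).sum with h1 | h1
          · left; omega
          · exact Or.inr ⟨_, Or.inr ⟨h1, by rw [zero_add]⟩, by omega⟩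

lemma sum_peakAux (L : List (Fin l → ℕ)) (acc : Fin l → ℕ) :
    (VComp.peakAux acc L).sum = acc + L.sum := by
  induction L generalizing acc with
  | nil => unfold VComp.peakAux; split_ifs with h <;> simp [h]
  | cons v L ih =>
    unfold VComp.peakAux
    split_ifs with h
    · rw [ih, List.sum_cons, add_assoc]
    · rw [List.sum_cons, ih, List.sum_cons, zero_add, add_assoc]

lemma mem_peakSet {K : VComp l} {d : ℕ} :
    d ∈ K.peakSet ↔ d < K.weight ∧ ends (fun v => wt v ≠ 1) K.1 d := by
  have hw : K.peak.weight = K.weight := by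
    rw [K.peak.weight_eq, K.weight_eq]
    refine congrArg wt ?_
    exact (sum_peakAux K.1 0).trans (zero_add _)
  unfold VComp.peakSet
  rw [mem_dset, hw]
  refine and_congr_right fun hd => ?_
  change ends _ (VComp.peakAux 0 K.1) d ↔ _
  rw [ends_peakAux, wt_zero]
  have hK : (K.1.map wt).sum = K.weight := rfl
  rw [hK]
  constructor
  · rintro (⟨e, he, rfl⟩ | ⟨-, rfl⟩)
    · rwa [zero_add]
    · omega
  · intro h
    exact Or.inl ⟨d, h, (zero_add d).symm⟩

/-- All columns have weight `1` or `2`, and the last one (if any) has weight `1`. -/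
def IsPeakList : List (Fin l → ℕ) → Prop
  | [] => True
  | v :: L => (wt v = 1 ∨ wt v = 2 ∧ L ≠ []) ∧ IsPeakList L

lemma isPeakList_iff (L : List (Fin l → ℕ)) :
    IsPeakList L ↔ (∀ v ∈ L, wt v = 1 ∨ wt v = 2) ∧ ∀ v ∈ L.getLast?, wt v = 1 := by
  induction L with
  | nil => simp [IsPeakList]
  | cons v L ih =>
    rw [IsPeakList, ih]
    cases L with
    | nil => simp +contextual
    | cons w L =>
      rw [List.getLast?_cons_cons]
      simp only [List.mem_cons, forall_eq_or_imp, ne_eq, reduceCtorEq, not_false_eq_true, and_true]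
      tauto

lemma IsPeakList.ne_zero {L : List (Fin l → ℕ)} (h : IsPeakList L) : ∀ v ∈ L, v ≠ 0 := by
  rintro v hv rfl
  have := ((isPeakList_iff L).1 h).1 0 hv
  simp [wt_zero] at this

lemma IsPeakList.ends_lt {L : List (Fin l → ℕ)} (h : IsPeakList L) {d : ℕ}
    (hd : ends (fun v => wt v ≠ 1) L d) : d < (L.map wt).sum := by
  induction L generalizing d with
  | nil => exact hd.elim
  | cons v L ih =>
    rw [List.map_cons, List.sum_cons]
    rcases hd with ⟨hv, rfl⟩ | ⟨e, he, rfl⟩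
    · have := weight_pos h.2.ne_zero (h.1.resolve_left hv).2
      omega
    · have := ih h.2 he
      omega

lemma IsPeakList.two_le {L : List (Fin l → ℕ)} (h : IsPeakList L) {d : ℕ}
    (hd : ends (fun v => wt v ≠ 1) L d) : 2 ≤ d := by
  induction L generalizing d with
  | nil => exact hd.elim
  | cons v L ih =>
    rcases hd with ⟨hv, rfl⟩ | ⟨e, he, rfl⟩
    · exact ((h.1.resolve_left hv).1).ge
    · have := ih h.2 he
      omega

lemma IsPeakList.not_succ {L : List (Fin l → ℕ)} (h : IsPeakList L) {d : ℕ}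
    (hd : ends (fun v => wt v ≠ 1) L d) : ¬ ends (fun v => wt v ≠ 1) L (d + 1) := by
  induction L generalizing d with
  | nil => exact hd.elim
  | cons v L ih =>
    rintro (⟨hv, hv'⟩ | ⟨e', he', h'⟩)
    · rcases hd with ⟨-, rfl⟩ | ⟨e, he, rfl⟩ <;> omega
    · rcases hd with ⟨hv, rfl⟩ | ⟨e, he, rfl⟩
      · have := h.2.two_le he'
        omega
      · exact ih h.2 he ((show e' = e + 1 by omega) ▸ he')

/-- A position is the end of a column of weight `1`, the end of a column of weight `2`, or the
middle of one; in the last case the next position is the end of that column. -/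
lemma IsPeakList.ends_odd_iff {L : List (Fin l → ℕ)} (h : IsPeakList L) {d : ℕ} (h1 : 1 ≤ d)
    (hd : d ≤ (L.map wt).sum) :
    ends (fun v => Odd (wt v)) L d ↔
      ¬ ends (fun v => wt v ≠ 1) L d ∧ ¬ ends (fun v => wt v ≠ 1) L (d + 1) := by
  induction L generalizing d with
  | nil => simp at hd; omega
  | cons v L ih =>
    rw [List.map_cons, List.sum_cons] at hd
    have h2 := fun e (he : ends (fun v => wt v ≠ 1) L e) => h.2.two_le he
    have h3 := fun e (he : ends (fun v => Odd (wt v)) L e) => ends_pos h.2.ne_zero he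
    have key : ∀ p : (Fin l → ℕ) → Prop, ∀ e, (∃ e', ends p L e' ∧ wt v + e = wt v + e') ↔
        ends p L e := fun p e =>
      ⟨fun ⟨e', he', h'⟩ => (Nat.add_left_cancel h') ▸ he', fun he => ⟨e, he, rfl⟩⟩
    rcases h.1 with hv | ⟨hv, -⟩
    · simp only [ends, hv, ne_eq, not_true, false_and, false_or, odd_one, true_and]
      rcases eq_or_lt_of_le h1 with rfl | h1
      · simp only [true_or, true_iff]
        constructor
        · rintro ⟨e, he, h'⟩
          have := h2 e he
          omega
        · rintro ⟨e, he, h'⟩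
          have := h2 e he
          omega
      · obtain ⟨e, rfl⟩ : ∃ e, d = 1 + e := ⟨d - 1, by omega⟩
        have k := fun p e => hv ▸ key p e
        rw [add_assoc, k, k, k, ← ih h.2 (by omega) (by omega)]
        simp only [or_iff_right_iff_imp]
        omega
    · have hodd : ¬ Odd 2 := by decide
      simp only [ends, hv, ne_eq, hodd, false_and, false_or]
      rcases eq_or_lt_of_le h1 with rfl | h1
      · constructor
        · rintro ⟨e, he, h'⟩
          have := h3 e he
          omega
        · intro h'
          exact absurd (Or.inl (by simp)) h'.2
      rcases Nat.eq_or_lt_of_le (Nat.succ_le_of_lt h1) with rfl | h1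
      · constructor
        · rintro ⟨e, he, h'⟩
          have := h3 e he
          omega
        · intro h'
          exact absurd (Or.inl (by simp)) h'.1
      · obtain ⟨e, rfl⟩ : ∃ e, d = 2 + e := ⟨d - 2, by omega⟩
        have k := fun p e => hv ▸ key p e
        rw [add_assoc, k, k, k, ih h.2 (by omega) (by omega)]
        have e1 : e ≠ 0 := by omega
        simp [e1]

/-- `oddAux` drops whatever follows the last odd column; here the last column has weight `1`, so
nothing is lost. -/
lemma IsPeakList.sum_oddAux {L : List (Fin l → ℕ)} (h : IsPeakList L) (hne : L ≠ [])
    (acc : Fin l → ℕ) : (VComp.oddAux acc L).sum = acc + L.sum := by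
  induction L generalizing acc with
  | nil => exact absurd rfl hne
  | cons v L ih =>
    unfold VComp.oddAux
    by_cases hL : L = []
    · subst hL
      have : wt v = 1 := by simpa [IsPeakList] using h.1
      simp [this, VComp.oddAux]
    split_ifs with hv
    · rw [List.sum_cons, ih h.2 hL, List.sum_cons, zero_add, add_assoc]
    · rw [ih h.2 hL, List.sum_cons, add_assoc]

/-- The empty prefix is separate because its sum does not contain `acc`. -/
lemma prefix_oddAux (L : List (Fin l → ℕ)) (acc : Fin l → ℕ) (A : List (Fin l → ℕ))
    (hA : A <+: VComp.oddAux acc L) : A = [] ∨ ∃ B, B <+: L ∧ A.sum = acc + B.sum := by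
  induction L generalizing acc A with
  | nil => exact Or.inl (by simpa [VComp.oddAux] using hA)
  | cons v L ih =>
    unfold VComp.oddAux at hA
    split_ifs at hA with h
    · rcases List.prefix_cons_iff.1 hA with rfl | ⟨A, rfl, hA'⟩
      · exact Or.inl rfl
      · right
        rcases ih 0 A hA' with rfl | ⟨B, hB, hs⟩
        · exact ⟨[v], by simp, by simp⟩
        · exact ⟨v :: B, by simpa using hB, by simp [hs, add_assoc]⟩
    · rcases ih _ A hA with rfl | ⟨B, hB, hs⟩
      · exact Or.inl rfl
      · exact Or.inr ⟨v :: B, by simpa using hB, by simp [hs, add_assoc]⟩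

lemma odd_coarsens {K : VComp l} (h : IsPeakList K.1) : K.odd.Coarsens K := by
  refine coarsens_iff.2 ⟨?_, fun A hA => ?_⟩
  · by_cases hne : K.1 = []
    · simp [VComp.total, VComp.odd, hne, VComp.oddAux]
    · exact (h.sum_oddAux hne 0).trans (zero_add _)
  · rcases prefix_oddAux K.1 0 A hA with rfl | ⟨B, hB, hs⟩
    · exact ⟨[], by simp, rfl⟩
    · exact ⟨B, hB, by rw [hs, zero_add]⟩

lemma mem_peakSet_iff {K : VComp l} (h : IsPeakList K.1) {d : ℕ} :
    d ∈ K.peakSet ↔ ends (fun v => wt v ≠ 1) K.1 d :=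
  mem_peakSet.trans ⟨fun h => h.2, fun hd => ⟨h.ends_lt hd, hd⟩⟩

lemma mem_dset_odd {K : VComp l} (h : IsPeakList K.1) {d : ℕ} :
    d ∈ K.odd.dset ↔ (1 ≤ d ∧ d < K.weight) ∧ d ∉ K.peakSet ∧ d + 1 ∉ K.peakSet := by
  rw [mem_dset, (odd_coarsens h).weight_eq, mem_peakSet_iff h, mem_peakSet_iff h]
  have : ends (fun _ => True) K.odd.1 d ↔ ends (fun v => Odd (wt v)) K.1 d := by
    refine (ends_oddAux K.1 0 d).trans ?_
    simp [wt_zero]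
  rw [this]
  constructor
  · rintro ⟨h1, h2⟩
    have h0 := ends_pos K.2 h2
    exact ⟨⟨h0, h1⟩, (h.ends_odd_iff h0 h1.le).1 h2⟩
  · rintro ⟨⟨h0, h1⟩, h2⟩
    exact ⟨h1, (h.ends_odd_iff h0 h1.le).2 h2⟩

lemma isPeakSubset_peakSet {K : VComp l} (h : IsPeakList K.1) :
    IsPeakSubset K.weight K.peakSet := by
  intro i hi
  have hi' := (mem_peakSet_iff h).1 hi
  have h2 := h.two_le hi'
  refine ⟨h2, h.ends_lt hi', fun h3 => h.not_succ ((mem_peakSet_iff h).1 h3) ?_⟩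
  rwa [Nat.sub_add_cancel (by omega)]

/-! ### Coordinate vector compositions -/

lemma coarsens_coord_word (K : VComp l) : K.Coarsens (VComp.coord K.word) := by
  refine ⟨K.1.map fun v => VComp.coord (VComp.colWord v), ?_, ?_⟩
  · rw [List.map_map]
    change _ = (K.1.flatMap VComp.colWord).map _
    rw [List.map_flatMap, List.flatMap_def]
    rfl
  · rw [List.map_map]
    conv_rhs => rw [← List.map_id K.1]
    exact List.map_congr_left fun v _ => sum_colWord v

lemma weight_coord (u : List (Fin l)) : (VComp.coord u).weight = u.length := by
  unfold VComp.weight VComp.coord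
  simp [Function.comp_def, wt_single]

/-- Reading a column sorts the block of `w` that it comes from, and blocks of a sorted word are
already sorted. -/
lemma VComp.Coarsens.word_eq_of_pairwise {J : VComp l} {w : List (Fin l)}
    (h : J.Coarsens (VComp.coord w)) (hw : w.Pairwise (· ≤ ·)) : J.word = w := by
  obtain ⟨P, hP, hJ⟩ := h
  unfold VComp.word
  rw [← hJ]
  clear hJ
  induction P generalizing w with
  | nil =>
    have : w = [] := by simpa [VComp.coord] using hP.symm
    simp [this]
  | cons Q P ih =>
    rw [List.map_cons, List.flatten_cons] at hP
    obtain ⟨w₁, w₂, rfl, h1, h2⟩ := List.map_eq_append_iff.1 hP.symm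
    rw [List.pairwise_append] at hw
    rw [List.map_cons, List.flatMap_cons, ih hw.2.1 h2.symm]
    unfold VComp.total
    rw [← h1, colWord_sum hw.1]

/-- The hypothesis on `I` says that each block of `u` summed to a column of `I` is sorted. Inside
such a block, the columns of `J` therefore read off the same letters in the same order. -/
lemma word_eq_of_coarsens {I J : VComp l} {u : List (Fin l)} (hIJ : I.Coarsens J)
    (hJ : J.Coarsens (VComp.coord u)) (hI : I.word = u) : J.word = u := by
  obtain ⟨P, hP, hP'⟩ := hIJ
  unfold VComp.word at hI
  rw [← hP'] at hI
  clear hP'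
  induction P generalizing u J with
  | nil =>
    unfold VComp.word
    rw [← hP, ← hI]
    rfl
  | cons Q P ih =>
    rw [List.map_cons, List.flatMap_cons] at hI
    rw [List.map_cons, List.flatten_cons] at hP
    have hm : ∀ v ∈ (P.map Subtype.val).flatten, v ≠ 0 := fun v hv =>
      J.2 v (hP ▸ List.mem_append_right _ hv)
    obtain ⟨I₁, I₂, hI12, hQ, hR⟩ :=
      coarsens_of_append (J₁ := Q) (J₂ := ⟨_, hm⟩) hJ hP.symm
    obtain ⟨u₁, u₂, rfl, h1, h2⟩ := List.map_eq_append_iff.1 hI12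
    have h1' : I₁ = VComp.coord u₁ := Subtype.ext h1.symm
    have h2' : I₂ = VComp.coord u₂ := Subtype.ext h2.symm
    subst h1' h2'
    obtain ⟨e1, e2⟩ := List.append_inj hI (by
      rw [length_colWord, ← VComp.weight_eq, hQ.weight_eq, weight_coord])
    have e3 : Q.word = u₁ := hQ.word_eq_of_pairwise (e1 ▸ pairwise_colWord _)
    have e4 := ih hR e2 rfl
    unfold VComp.word at e3 e4 ⊢
    rw [← hP, List.flatMap_append, e3, e4]

/-! ### Existence and uniqueness of peak compositions -/

lemma isPeakComp_iff {S : Finset ℕ} {u : List (Fin l)} {I : VComp l} :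
    IsPeakComp S u I ↔ IsPeakList I.1 ∧ I.word = u ∧ I.peakSet = S := by
  rw [isPeakList_iff]
  exact ⟨fun h => ⟨⟨h.wt_mem, h.wt_last⟩, h.word_eq, h.peakSet_eq⟩,
    fun h => ⟨h.1.1, h.1.2, h.2.1, h.2.2⟩⟩

/-- The ends of weight-2 columns determine the weight of the first column, the word then determines
the column, and both data pass to the rest. -/
lemma IsPeakList.eq_of_ends_iff {K L : List (Fin l → ℕ)} (hK : IsPeakList K) (hL : IsPeakList L)
    (hw : K.flatMap VComp.colWord = L.flatMap VComp.colWord)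
    (he : ∀ d, ends (fun v => wt v ≠ 1) K d ↔ ends (fun v => wt v ≠ 1) L d) : K = L := by
  induction K generalizing L with
  | nil =>
    by_contra h
    have := weight_pos hL.ne_zero (Ne.symm h)
    rw [← length_word, ← hw] at this
    simp at this
  | cons v K ih =>
    cases L with
    | nil =>
      exfalso
      have := weight_pos hK.ne_zero (by simp)
      rw [← length_word, hw] at this
      simp at this
    | cons v' L =>
      -- The first column has weight `2` iff position `2` is an end: a later weight-2 column ends at
      -- position `3` or beyond.
      have key : ∀ {w w' : Fin l → ℕ} {A B : List (Fin l → ℕ)}, IsPeakList (w :: A) →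
          IsPeakList (w' :: B) → (∀ d, ends (fun v => wt v ≠ 1) (w :: A) d →
            ends (fun v => wt v ≠ 1) (w' :: B) d) → wt w = 2 → wt w' = 2 := by
        intro w w' A B hA hB h hw
        rcases h 2 (Or.inl ⟨by omega, hw.symm⟩) with ⟨-, h'⟩ | ⟨e, he, h'⟩
        · exact h'.symm
        · have := hB.2.two_le he
          have := wt_pos (hB.ne_zero w' (by simp))
          omega
      have hwt : wt v = wt v' := by
        have h1 := key hK hL fun d => (he d).1
        have h2 := key hL hK fun d => (he d).2
        have h3 := hK.1
        have h4 := hL.1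
        omega
      rw [List.flatMap_cons, List.flatMap_cons] at hw
      obtain ⟨e1, e2⟩ := List.append_inj hw (by rw [length_colWord, length_colWord, hwt])
      obtain rfl := colWord_injective e1
      rw [ih hK.2 hL.2 e2 fun d => ?_]
      rcases Nat.eq_zero_or_pos d with rfl | h0
      · exact ⟨fun h => absurd (hK.2.two_le h) (by omega),
          fun h => absurd (hL.2.two_le h) (by omega)⟩
      have hd : ∀ {A : List (Fin l → ℕ)},
          (ends (fun v => wt v ≠ 1) (v :: A) (wt v + d) ↔ ends (fun v => wt v ≠ 1) A d) := by
        intro A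
        constructor
        · rintro (⟨hv, h⟩ | ⟨e, he, h⟩)
          · omega
          · exact (Nat.add_left_cancel h) ▸ he
        · intro h
          exact Or.inr ⟨d, h, rfl⟩
      rw [← hd, ← hd, he]

lemma IsPeakComp.unique {S : Finset ℕ} {u : List (Fin l)} {I J : VComp l}
    (hI : IsPeakComp S u I) (hJ : IsPeakComp S u J) : I = J := by
  rw [isPeakComp_iff] at hI hJ
  refine Subtype.ext (hI.1.eq_of_ends_iff hJ.1 (hI.2.1.trans hJ.2.1.symm) fun d => ?_)
  rw [← mem_peakSet_iff hI.1, ← mem_peakSet_iff hJ.1, hI.2.2, hJ.2.2]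

lemma IsPeakComp.peakComp_eq {S : Finset ℕ} {u : List (Fin l)} {I : VComp l}
    (hI : IsPeakComp S u I) : peakComp S u = I := by
  have h : ∃ I : VComp l, IsPeakComp S u I := ⟨I, hI⟩
  rw [peakComp, dif_pos h]
  exact h.choose_spec.unique hI

lemma exists_pair {v : Fin l → ℕ} (hv : wt v = 2) :
    ∃ a b : Fin l, VComp.colWord v = [a, b] := by
  rw [← length_colWord] at hv
  exact List.length_eq_two.1 hv

/-- A weight-2 column whose end is not in `T` is split into two coordinate columns, written in the
order of its colouring word. -/
lemma IsPeakList.exists_of_subset {K : List (Fin l → ℕ)} (hK : IsPeakList K) (T : Set ℕ)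
    (hT : ∀ d ∈ T, ends (fun v => wt v ≠ 1) K d) :
    ∃ L, IsPeakList L ∧ L.flatMap VComp.colWord = K.flatMap VComp.colWord ∧
      (K ≠ [] → L ≠ []) ∧ ∀ d, ends (fun v => wt v ≠ 1) L d ↔ d ∈ T := by
  induction K generalizing T with
  | nil => exact ⟨[], hK, rfl, fun h => h, fun d => ⟨fun h => h.elim, fun h => (hT d h).elim⟩⟩
  | cons v K ih =>
    -- The value `e = 0` is the end of `v` itself and does not belong to the tail.
    obtain ⟨L, hL, hw, hne, he⟩ := ih hK.2 {e | wt v + e ∈ T ∧ e ≠ 0} (by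
      rintro e ⟨he, h0⟩
      rcases hT _ he with ⟨-, h⟩ | ⟨e', he', h⟩
      · omega
      · exact (Nat.add_left_cancel h) ▸ he')
    have hT' : ∀ d ∈ T, (wt v ≠ 1 ∧ d = wt v) ∨ (∃ e, d = wt v + e ∧ e ≠ 0) := by
      intro d hd
      refine (hT d hd).imp id ?_
      rintro ⟨e, he, h⟩
      exact ⟨e, h, (ends_pos hK.2.ne_zero he).ne'⟩
    by_cases h2 : wt v ∈ T ∨ wt v = 1
    · refine ⟨v :: L, ⟨hK.1.imp id fun h => ⟨h.1, hne h.2⟩, hL⟩, by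
        rw [List.flatMap_cons, List.flatMap_cons, hw], by simp, fun d => ?_⟩
      simp only [ends, he, Set.mem_ofPred_eq]
      constructor
      · rintro (⟨h1, rfl⟩ | ⟨e, ⟨h, -⟩, rfl⟩)
        · exact h2.resolve_right h1
        · exact h
      · intro hd
        rcases hT' d hd with h | ⟨e, rfl, h0⟩
        · exact Or.inl h
        · exact Or.inr ⟨e, ⟨hd, h0⟩, rfl⟩
    · push Not at h2
      obtain ⟨hv, hne'⟩ := hK.1.resolve_left h2.2
      obtain ⟨a, b, hab⟩ := exists_pair hv
      refine ⟨Pi.single a 1 :: Pi.single b 1 :: L,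
        ⟨Or.inl (wt_single a), Or.inl (wt_single b), hL⟩, ?_, by simp, fun d => ?_⟩
      · simp [colWord_single, hw, hab]
      · simp only [ends, he, Set.mem_ofPred_eq, wt_single, ne_eq, not_true, false_and, false_or]
        constructor
        · rintro ⟨_, ⟨e, ⟨h, -⟩, rfl⟩, rfl⟩
          rw [hv] at h
          convert h using 1
          omega
        · intro hd
          rcases hT' d hd with ⟨-, rfl⟩ | ⟨e, rfl, h0⟩
          · exact absurd hd h2.1
          · exact ⟨_, ⟨e, ⟨hd, h0⟩, rfl⟩, by omega⟩

lemma IsPeakComp.exists_of_subset {S T : Finset ℕ} {u : List (Fin l)} {I : VComp l}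
    (hI : IsPeakComp S u I) (hT : T ⊆ S) : ∃ J : VComp l, IsPeakComp T u J := by
  rw [isPeakComp_iff] at hI
  obtain ⟨L, hL, hw, -, he⟩ := hI.1.exists_of_subset T fun d hd =>
    (mem_peakSet_iff hI.1).1 (hI.2.2 ▸ hT hd)
  refine ⟨⟨L, hL.ne_zero⟩, isPeakComp_iff.2 ⟨hL, hw.trans hI.2.1, ?_⟩⟩
  ext d
  rw [mem_peakSet_iff (K := ⟨L, _⟩) hL]
  simpa using he d

lemma IsPeakComp.odd_coarsens_coord {S : Finset ℕ} {u : List (Fin l)} {I : VComp l}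
    (hI : IsPeakComp S u I) : I.odd.Coarsens (VComp.coord u) := by
  rw [← hI.word_eq]
  exact (odd_coarsens (isPeakComp_iff.1 hI).1).trans (coarsens_coord_word I)

lemma IsPeakComp.mem_dset_odd {S : Finset ℕ} {u : List (Fin l)} {I : VComp l}
    (hI : IsPeakComp S u I) {d : ℕ} :
    d ∈ I.odd.dset ↔ (1 ≤ d ∧ d < u.length) ∧ d ∉ S ∧ d + 1 ∉ S := by
  rw [LevelQSym.mem_dset_odd (isPeakComp_iff.1 hI).1, hI.peakSet_eq, ← hI.word_eq,
    I.length_word]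

/-- Fewer peaks leave more descents: `odd I_{S,u}` coarsens `odd I_{T,u}`, which coarsens `E_u`, so
the word condition is inherited. -/
lemma Admissible.mono {S T : Finset ℕ} {u : List (Fin l)} (h : Admissible S u) (hT : T ⊆ S) :
    Admissible T u := by
  obtain ⟨hS, I, hI, hu⟩ := h
  obtain ⟨J, hJ⟩ := hI.exists_of_subset hT
  refine ⟨fun i hi => ⟨(hS i (hT hi)).1, (hS i (hT hi)).2.1, fun h' => (hS i (hT hi)).2.2 (hT h')⟩,
    J, hJ, word_eq_of_coarsens (I := I.odd) ?_ hJ.odd_coarsens_coord hu⟩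
  rw [coarsens_iff_dset_subset hI.odd_coarsens_coord hJ.odd_coarsens_coord]
  intro d
  rw [hI.mem_dset_odd, hJ.mem_dset_odd]
  exact fun h => ⟨h.1, fun h' => h.2.1 (hT h'), fun h' => h.2.2 (hT h')⟩

/-! ### Odd vector compositions and admissible pairs -/

lemma odd_oddAux (L : List (Fin l → ℕ)) (acc : Fin l → ℕ) (hacc : Even (wt acc)) :
    ∀ v ∈ VComp.oddAux acc L, Odd (wt v) := by
  induction L generalizing acc with
  | nil => simp [VComp.oddAux]
  | cons v L ih =>
    unfold VComp.oddAux
    split_ifs with h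
    · rw [List.forall_mem_cons, wt_add]
      exact ⟨hacc.add_odd h, ih 0 (by simp [wt_zero])⟩
    · exact ih _ (by rw [wt_add]; exact hacc.add (Nat.not_odd_iff_even.1 h))

lemma isOdd_odd (I : VComp l) : I.odd.IsOdd := odd_oddAux I.1 0 (by simp [wt_zero])

/-- The pairs have even weight and the final letter has weight `1`, so `oddAux` outputs exactly one
column for the whole word and starts afresh on `R`. The accumulator must be general for the
induction on pairs. -/
lemma pairUp_spec : ∀ (w : List (Fin l)), Odd w.length → ∀ R : List (Fin l → ℕ),
    (IsPeakList R → IsPeakList (VComp.pairUp w ++ R)) ∧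
    (w.Pairwise (· ≤ ·) → (VComp.pairUp w).flatMap VComp.colWord = w) ∧
    ∀ acc : Fin l → ℕ, Even (wt acc) → VComp.oddAux acc (VComp.pairUp w ++ R) =
      (acc + (w.map fun i => (Pi.single i 1 : Fin l → ℕ)).sum) :: VComp.oddAux 0 R
  | [], h, _ => by simp at h
  | [a], _, R => by
    simp [VComp.pairUp, IsPeakList, wt_single, colWord_single, VComp.oddAux]
  | a :: b :: w, h, R => by
    have hw : Odd w.length := by
      rw [List.length_cons, List.length_cons] at h
      rcases h with ⟨k, hk⟩
      exact ⟨k - 1, by omega⟩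
    obtain ⟨h1, h2, h3⟩ := pairUp_spec w hw R
    have h4 : wt (Pi.single a 1 + Pi.single b 1 : Fin l → ℕ) = 2 := by
      rw [wt_add, wt_single, wt_single]
    have hne : VComp.pairUp w ++ R ≠ [] := by
      cases w with
      | nil => simp at hw
      | cons c w => cases w <;> simp [VComp.pairUp]
    refine ⟨fun hR => ⟨Or.inr ⟨h4, hne⟩, h1 hR⟩, fun hs => ?_, fun acc hacc => ?_⟩
    · simp only [List.pairwise_cons, List.mem_cons, forall_eq_or_imp] at hs
      simp [VComp.pairUp, colWord_pair hs.1.1, h2 hs.2.2]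
    · have hodd : ¬ Odd (wt (Pi.single a 1 + Pi.single b 1 : Fin l → ℕ)) := by
        rw [h4]; decide
      rw [VComp.pairUp, List.cons_append, VComp.oddAux, if_neg hodd,
        h3 _ (by rw [wt_add, h4]; exact hacc.add even_two)]
      simp [add_assoc]

lemma tilde_spec (L : List (Fin l → ℕ)) (hL : ∀ v ∈ L, Odd (wt v)) :
    IsPeakList (L.flatMap fun v => VComp.pairUp (VComp.colWord v)) ∧
    (L.flatMap fun v => VComp.pairUp (VComp.colWord v)).flatMap VComp.colWord =
      L.flatMap VComp.colWord ∧
    VComp.oddAux 0 (L.flatMap fun v => VComp.pairUp (VComp.colWord v)) = L := by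
  induction L with
  | nil => simp [IsPeakList, VComp.oddAux]
  | cons v L ih =>
    obtain ⟨h1, h2, h3⟩ := ih fun w hw => hL w (by simp [hw])
    obtain ⟨k1, k2, k3⟩ := pairUp_spec (VComp.colWord v)
      (by rw [length_colWord]; exact hL v (by simp))
      (L.flatMap fun v => VComp.pairUp (VComp.colWord v))
    rw [List.flatMap_cons]
    refine ⟨k1 h1, ?_, ?_⟩
    · rw [List.flatMap_append, k2 (pairwise_colWord v), h2, List.flatMap_cons]
    · rw [k3 0 (by simp [wt_zero]), h3, sum_colWord, zero_add]

lemma VComp.IsOdd.odd_tilde {I : VComp l} (hI : I.IsOdd) : I.tilde.odd = I :=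
  Subtype.ext (tilde_spec I.1 hI).2.2

lemma VComp.IsOdd.isPeakComp_tilde {I : VComp l} (hI : I.IsOdd) :
    IsPeakComp I.tilde.peakSet I.word I.tilde :=
  isPeakComp_iff.2 ⟨(tilde_spec I.1 hI).1, (tilde_spec I.1 hI).2.1, rfl⟩

lemma VComp.IsOdd.admissible {I : VComp l} (hI : I.IsOdd) :
    Admissible I.tilde.peakSet I.word := by
  refine ⟨?_, I.tilde, hI.isPeakComp_tilde, by rw [hI.odd_tilde]⟩
  have := isPeakSubset_peakSet (isPeakComp_iff.1 hI.isPeakComp_tilde).1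
  rwa [← I.tilde.length_word, hI.isPeakComp_tilde.word_eq] at this

/-- Descending induction: if `d + 1` is in the set then `d` is not; otherwise the hypothesis at `d`
decides whether `d` is. -/
lemma IsPeakSubset.eq_of_forall {n : ℕ} {S T : Finset ℕ} (hS : IsPeakSubset n S)
    (hT : IsPeakSubset n T)
    (h : ∀ d, 1 ≤ d → d < n → (d ∉ S ∧ d + 1 ∉ S ↔ d ∉ T ∧ d + 1 ∉ T)) : S = T := by
  have key : ∀ k d, n ≤ d + k → (d ∈ S ↔ d ∈ T) := by
    intro k
    induction k with
    | zero =>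
      intro d hd
      exact ⟨fun h => absurd (hS d h).2.1 (by omega), fun h => absurd (hT d h).2.1 (by omega)⟩
    | succ k ih =>
      intro d hd
      have h1 := ih (d + 1) (by omega)
      rcases Nat.eq_zero_or_pos d with rfl | h0
      · exact ⟨fun h => absurd (hS 0 h).1 (by omega), fun h => absurd (hT 0 h).1 (by omega)⟩
      by_cases hn : n ≤ d
      · exact ih d (by omega)
      have h2 := h d h0 (by omega)
      have h3 : d + 1 ∈ S → d ∉ S := fun h => (hS _ h).2.2
      have h4 : d + 1 ∈ T → d ∉ T := fun h => (hT _ h).2.2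
      tauto
  ext d
  exact key n d (by omega)

/-- `I` and `I.odd.tilde` have the same odd coarsening, whose descent set determines the peak set.
-/
lemma Admissible.tilde_odd {S : Finset ℕ} {u : List (Fin l)} (h : Admissible S u) {I : VComp l}
    (hI : IsPeakComp S u I) : I.odd.word = u ∧ I.odd.tilde.peakSet = S := by
  obtain ⟨hS, I', hI', hu⟩ := h
  obtain rfl := hI'.unique hI
  refine ⟨hu, ?_⟩
  have ht := (isOdd_odd I').isPeakComp_tilde
  have hadm := (isOdd_odd I').admissible.1
  rw [hu] at ht hadm
  refine hadm.eq_of_forall hS fun d h1 h2 => ?_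
  have := hI'.mem_dset_odd (d := d)
  have h3 := ht.mem_dset_odd (d := d)
  rw [(isOdd_odd I').odd_tilde] at h3
  tauto

/-- Admissible pairs correspond to odd vector compositions. -/
noncomputable def admissibleEquiv (l : ℕ) :
    {p : Finset ℕ × List (Fin l) // Admissible p.1 p.2} ≃ {I : VComp l // I.IsOdd} where
  toFun p := ⟨(peakComp p.1.1 p.1.2).odd, isOdd_odd _⟩
  invFun I := ⟨(I.1.tilde.peakSet, I.1.word), I.2.admissible⟩
  left_inv := by
    rintro ⟨⟨S, u⟩, h⟩
    obtain ⟨I, hI, -⟩ := h.2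
    obtain ⟨h1, h2⟩ := h.tilde_odd hI
    apply Subtype.ext
    simp only [hI.peakComp_eq, h1, h2]
  right_inv := by
    rintro ⟨I, hI⟩
    apply Subtype.ext
    change (peakComp I.tilde.peakSet I.word).odd = I
    rw [hI.isPeakComp_tilde.peakComp_eq, hI.odd_tilde]

/-! ### Peak functions in terms of the functions `η` -/

lemma IsPeakComp.eta_odd {T : Finset ℕ} {u : List (Fin l)} {K : VComp l} (hK : IsPeakComp T u K) :
    eta K.odd = ∑ J ∈ (finite_coarsens (VComp.coord u)).toFinset with
      Disjoint T (J.dset ∪ J.dset.image (· + 1)), (2 : ℚ) ^ J.len • M J := by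
  classical
  unfold eta
  congr 1
  ext J
  rw [Finset.mem_filter, Set.Finite.mem_toFinset, Set.Finite.mem_toFinset, Set.mem_ofPred_eq,
    Set.mem_ofPred_eq]
  have hc := hK.odd_coarsens_coord
  have key : ∀ hJ : J.Coarsens (VComp.coord u), J.dset ⊆ K.odd.dset ↔
      Disjoint T (J.dset ∪ J.dset.image (· + 1)) := by
    intro hJ
    rw [Finset.disjoint_right]
    constructor
    · intro h d hd
      rcases Finset.mem_union.1 hd with hd | hd
      · exact (hK.mem_dset_odd.1 (h hd)).2.1
      · obtain ⟨e, he, rfl⟩ := Finset.mem_image.1 hd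
        exact (hK.mem_dset_odd.1 (h he)).2.2
    · intro h d hd
      have := Finset.mem_Ico.1 (dset_subset J hd)
      rw [hJ.weight_eq, weight_coord] at this
      exact hK.mem_dset_odd.2 ⟨this, h (Finset.mem_union_left _ hd),
        h (Finset.mem_union_right _ (Finset.mem_image_of_mem _ hd))⟩
  constructor
  · intro h
    have hJ := h.trans hc
    exact ⟨hJ, (key hJ).1 h.dset_subset⟩
  · rintro ⟨hJ, h⟩
    exact (coarsens_iff_dset_subset hJ hc).2 ((key hJ).2 h)

lemma sum_powerset_subset (S X : Finset ℕ) :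
    ∑ T ∈ S.powerset, (-1 : ℚ) ^ T.card * (if T ⊆ X then 1 else 0) =
      if Disjoint S X then 1 else 0 := by
  classical
  simp only [mul_ite, mul_one, mul_zero]
  rw [← Finset.sum_filter]
  have : (S.powerset.filter fun T => T ⊆ X) = (S ∩ X).powerset := by
    ext T
    rw [Finset.mem_filter, Finset.mem_powerset, Finset.mem_powerset, Finset.subset_inter_iff]
  rw [this, if_congr Finset.disjoint_iff_inter_eq_empty rfl rfl]
  have h := Finset.sum_powerset_neg_one_pow_card (x := S ∩ X)
  have h' := congrArg (Int.cast : ℤ → ℚ) h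
  push_cast at h'
  exact h'

/-- This is the previous identity for `S \ X`: a subset of `S` is disjoint from `X` iff it lies in
`S \ X`. -/
lemma sum_powerset_disjoint (S X : Finset ℕ) :
    ∑ T ∈ S.powerset, (-1 : ℚ) ^ T.card * (if Disjoint T X then 1 else 0) =
      if S ⊆ X then 1 else 0 := by
  classical
  have h := sum_powerset_subset S (S \ X)
  have h1 : Disjoint S (S \ X) ↔ S ⊆ X := by
    rw [← Finset.sdiff_eq_empty_iff_subset, Finset.disjoint_iff_inter_eq_empty,
      Finset.inter_eq_right.2 Finset.sdiff_subset]
  rw [if_congr h1 rfl rfl] at h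
  rw [← h]
  refine Finset.sum_congr rfl fun T hT => ?_
  rw [Finset.mem_powerset] at hT
  congr 2
  rw [Finset.subset_sdiff]
  simp [hT]

lemma Admissible.theta_eq {S : Finset ℕ} {u : List (Fin l)} (h : Admissible S u) :
    theta S u = ∑ T ∈ S.powerset, (-1 : ℚ) ^ T.card • eta (peakComp T u).odd := by
  classical
  have h1 : ∀ T ∈ S.powerset, (-1 : ℚ) ^ T.card • eta (peakComp T u).odd =
      ∑ J ∈ (finite_coarsens (VComp.coord u)).toFinset,
        ((-1 : ℚ) ^ T.card * if Disjoint T (J.dset ∪ J.dset.image (· + 1)) then 1 else 0) •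
          (2 : ℚ) ^ J.len • M J := by
    intro T hT
    obtain ⟨I, hI, -⟩ := (h.mono (Finset.mem_powerset.1 hT)).2
    rw [hI.peakComp_eq, hI.eta_odd, Finset.sum_filter, Finset.smul_sum]
    refine Finset.sum_congr rfl fun J _ => ?_
    split_ifs <;> simp
  rw [Finset.sum_congr rfl h1, Finset.sum_comm, theta, Finset.sum_filter]
  refine Finset.sum_congr rfl fun J _ => ?_
  rw [← Finset.sum_smul, sum_powerset_disjoint]
  split_ifs <;> simp

lemma VComp.IsOdd.eta_eq {I : VComp l} (hI : I.IsOdd) :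
    eta I = ∑ S ∈ I.tilde.peakSet.powerset, (-1 : ℚ) ^ S.card • theta S I.word := by
  classical
  have h1 : ∀ S ∈ I.tilde.peakSet.powerset, (-1 : ℚ) ^ S.card • theta S I.word =
      ∑ J ∈ (finite_coarsens (VComp.coord I.word)).toFinset,
        ((-1 : ℚ) ^ S.card * if S ⊆ J.dset ∪ J.dset.image (· + 1) then 1 else 0) •
          (2 : ℚ) ^ J.len • M J := by
    intro S _
    rw [theta, Finset.sum_filter, Finset.smul_sum]
    refine Finset.sum_congr rfl fun J _ => ?_
    split_ifs <;> simp
  rw [Finset.sum_congr rfl h1, Finset.sum_comm]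
  have h2 := hI.isPeakComp_tilde.eta_odd
  rw [hI.odd_tilde] at h2
  rw [h2, Finset.sum_filter]
  refine Finset.sum_congr rfl fun J _ => ?_
  rw [← Finset.sum_smul, sum_powerset_subset]
  split_ifs <;> simp

/-! ### Coefficients and the coproduct -/

lemma VComp.len_eq_zero {I : VComp l} : I.len = 0 ↔ I.1 = [] := List.length_eq_zero_iff

/-- The concatenation of two vector compositions. -/
def VComp.append (I J : VComp l) : VComp l :=
  ⟨I.1 ++ J.1, fun v hv => (List.mem_append.1 hv).elim (I.2 v) (J.2 v)⟩

open Classical in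
lemma repr_M (I J : VComp l) : (monoBasis l).repr (M I) J = if I = J then 1 else 0 := by
  rw [M, Module.Basis.repr_self, Finsupp.single_apply]

lemma coeff_eq_repr (f : QSym l) (d : ℕ × Fin l →₀ ℕ) :
    MvPowerSeries.coeff d (f : MvPowerSeries (ℕ × Fin l) ℚ) = (monoBasis l).repr f (cols d) := by
  obtain ⟨g, rfl⟩ := (ofFinsupp_bijective l).2 f
  have hg : (monoBasis l).repr (ofFinsupp l g) = g :=
    (LinearEquiv.ofBijective (ofFinsupp l) (ofFinsupp_bijective l)).symm_apply_apply g
  rw [hg]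
  rfl

lemma mem_homog_iff {n : Fin l → ℕ} {f : QSym l} :
    f ∈ homog n ↔ ∀ I, (monoBasis l).repr f I ≠ 0 → I.total = n := by
  constructor
  · intro h I hI
    have := h (stdExp I)
    rw [coeff_eq_repr, cols_stdExp] at this
    exact this hI
  · intro h d hd
    rw [coeff_eq_repr] at hd
    exact h _ hd

open Classical in
lemma repr_eta (I J : VComp l) :
    (monoBasis l).repr (eta I) J = if J.Coarsens I then 2 ^ J.len else 0 := by
  unfold eta
  rw [map_sum, Finsupp.finsetSum_apply]
  simp only [map_smul, Finsupp.smul_apply, repr_M, smul_eq_mul, mul_ite, mul_one, mul_zero]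
  rw [Finset.sum_ite_eq']
  simp

lemma eta_mem_homog (I : VComp l) : eta I ∈ homog I.total := by
  classical
  rw [mem_homog_iff]
  intro J hJ
  rw [repr_eta] at hJ
  by_cases h : J.Coarsens I
  · exact h.total_eq
  · simp [h] at hJ

lemma sum_take_drop (K A B : VComp l) [Decidable (K = A.append B)]
    [∀ k, Decidable (K.take k = A)] [∀ k, Decidable (K.drop k = B)] :
    (∑ k ∈ Finset.range (K.len + 1), (if K.take k = A then (1 : ℚ) else 0) *
      if K.drop k = B then 1 else 0) = if K = A.append B then 1 else 0 := by
  split_ifs with h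
  · subst h
    have hA : (A.append B).take A.len = A :=
      Subtype.ext (by simp [VComp.take, VComp.append, VComp.len])
    have hB : (A.append B).drop A.len = B :=
      Subtype.ext (by simp [VComp.drop, VComp.append, VComp.len])
    rw [Finset.sum_eq_single A.len]
    · rw [if_pos hA, if_pos hB, mul_one]
    · intro k hk hkA
      rw [if_neg, zero_mul]
      intro h
      have := len_take k (A.append B)
      rw [h] at this
      rw [Finset.mem_range] at hk
      omega
    · intro h
      exfalso
      apply h
      have : (A.append B).len = A.len + B.len := by simp [VComp.append, VComp.len]
      rw [Finset.mem_range]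
      omega
  · refine Finset.sum_eq_zero fun k _ => ?_
    by_cases h1 : K.take k = A
    · by_cases h2 : K.drop k = B
      · exact absurd (Subtype.ext (by
          rw [← h1, ← h2]
          exact (List.take_append_drop k K.1).symm)) h
      · simp [h2]
    · simp [h1]

/-- Deconcatenation is dual to concatenation, so identities for the coproduct can be checked on
coefficients. -/
lemma repr_comul (f : QSym l) (A B : VComp l) :
    ((monoBasis l).tensorProduct (monoBasis l)).repr (deconcat l f) (A, B) =
      (monoBasis l).repr f (A.append B) := by
  classical
  have : (Finsupp.lapply (A, B)) ∘ₗ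
      ((monoBasis l).tensorProduct (monoBasis l)).repr.toLinearMap ∘ₗ deconcat l =
      (Finsupp.lapply (A.append B)) ∘ₗ (monoBasis l).repr.toLinearMap := by
    refine (monoBasis l).ext fun K => ?_
    change ((monoBasis l).tensorProduct (monoBasis l)).repr (deconcat l (M K)) (A, B) =
      (monoBasis l).repr (M K) (A.append B)
    rw [deconcat_M, map_sum, Finsupp.finsetSum_apply, repr_M, ← sum_take_drop]
    refine Finset.sum_congr rfl fun k _ => ?_
    rw [Module.Basis.tensorProduct_repr_tmul_apply, repr_M, repr_M, smul_eq_mul, mul_comm]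
  exact LinearMap.congr_fun this f

lemma append_coarsens_iff {A B I : VComp l} : (A.append B).Coarsens I ↔
    ∃ k ∈ Finset.range (I.len + 1), A.Coarsens (I.take k) ∧ B.Coarsens (I.drop k) := by
  constructor
  · intro h
    obtain ⟨I₁, I₂, hI, h1, h2⟩ := coarsens_of_append h rfl
    have e1 : I.take I₁.len = I₁ := Subtype.ext (by
      change I.1.take I₁.1.length = _
      rw [hI]; simp)
    have e2 : I.drop I₁.len = I₂ := Subtype.ext (by
      change I.1.drop I₁.1.length = _
      rw [hI]; simp)
    refine ⟨I₁.len, ?_, by rwa [e1], by rwa [e2]⟩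
    have : I.len = I₁.len + I₂.len := by unfold VComp.len; rw [hI]; simp
    rw [Finset.mem_range]
    omega
  · rintro ⟨k, -, h1, h2⟩
    exact coarsens_append h1 h2 rfl (List.take_append_drop k I.1).symm

lemma deconcat_eta (I : VComp l) : deconcat l (eta I) =
    ∑ k ∈ Finset.range (I.len + 1), eta (I.take k) ⊗ₜ[ℚ] eta (I.drop k) := by
  classical
  apply ((monoBasis l).tensorProduct (monoBasis l)).repr.injective
  ext ⟨A, B⟩
  rw [repr_comul, map_sum, Finsupp.finsetSum_apply, repr_eta]
  simp only [Module.Basis.tensorProduct_repr_tmul_apply, repr_eta, smul_eq_mul]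
  split_ifs with h
  · obtain ⟨k, hk, h1, h2⟩ := append_coarsens_iff.1 h
    rw [Finset.sum_eq_single k]
    · rw [if_pos h1, if_pos h2, mul_comm, ← pow_add]
      congr 1
      simp [VComp.append, VComp.len]
    · intro j hj hjk
      rw [if_neg (c := A.Coarsens _), mul_zero]
      -- Two cuts whose left parts are both refinements of `A` have left parts of equal weight, so
      -- they coincide.
      intro h3
      have hw := h1.weight_eq.symm.trans h3.weight_eq
      have h4 := prefix_eq_of_weight_eq I.2 (List.take_prefix k _) (List.take_prefix j _) hw
      have h5 := congrArg List.length h4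
      rw [List.length_take, List.length_take] at h5
      rw [Finset.mem_range] at hk hj
      have : I.1.length = I.len := rfl
      omega
    · exact fun h => absurd hk h
  · refine (Finset.sum_eq_zero fun k hk => ?_).symm
    by_cases h1 : A.Coarsens (I.take k)
    · by_cases h2 : B.Coarsens (I.drop k)
      · exact absurd (append_coarsens_iff.2 ⟨k, hk, h1, h2⟩) h
      · simp [h2]
    · simp [h1]

/-! ### The characters on the functions `η` -/

lemma bar_M (φ : QSym l →ₗ[ℚ] ℚ) (I : VComp l) : bar φ (M I) = (-1) ^ I.weight * φ (M I) :=
  (monoBasis l).constr_basis ℚ _ I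

lemma bar_apply_of_mem_homog (φ : QSym l →ₗ[ℚ] ℚ) {n : Fin l → ℕ} {f : QSym l}
    (hf : f ∈ homog n) : bar φ f = (-1) ^ wt n * φ f := by
  rw [mem_homog_iff] at hf
  have hsum : f = ((monoBasis l).repr f).sum fun I c => c • M I :=
    ((monoBasis l).linearCombination_repr f).symm
  rw [hsum]
  unfold Finsupp.sum
  rw [map_sum, map_sum, Finset.mul_sum]
  refine Finset.sum_congr rfl fun I hI => ?_
  rw [map_smul, map_smul, bar_M, I.weight_eq, hf I (Finsupp.mem_support_iff.1 hI)]
  simp only [smul_eq_mul]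
  ring

lemma zetaInv_eq : zetaInv l = signLen l := rfl

lemma len_eq_zero_of_total {I : VComp l} (h : I.total = 0) : I.len = 0 := by
  rw [VComp.len_eq_zero]
  by_contra hne
  have := weight_pos I.2 hne
  rw [← wt_sum] at this
  change 0 < wt I.total at this
  rw [h, wt_zero] at this
  omega

lemma eq_of_len_le_one {I J : VComp l} (hI : I.len ≤ 1) (hJ : J.len ≤ 1)
    (h : I.total = J.total) : I = J := by
  have key : ∀ {I J : VComp l}, I.len = 0 → I.total = J.total → I = J := by
    intro I J hI h
    have h0 : J.len = 0 := len_eq_zero_of_total (by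
      rw [← h, VComp.total, VComp.len_eq_zero.1 hI, List.sum_nil])
    exact Subtype.ext ((VComp.len_eq_zero.1 hI).trans (VComp.len_eq_zero.1 h0).symm)
  rcases Nat.eq_zero_or_pos I.len with h1 | h1
  · exact key h1 h
  rcases Nat.eq_zero_or_pos J.len with h2 | h2
  · exact (key h2 h.symm).symm
  obtain ⟨v, hv⟩ := List.length_eq_one_iff.1 (le_antisymm hI h1)
  obtain ⟨w, hw⟩ := List.length_eq_one_iff.1 (le_antisymm hJ h2)
  unfold VComp.total at h
  rw [hv, hw, List.sum_singleton, List.sum_singleton] at h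
  exact Subtype.ext (by rw [hv, hw, h])

lemma zeta_eta (I : VComp l) : zeta l (eta I) = if I.len = 0 then 1 else 2 := by
  classical
  unfold eta
  rw [map_sum]
  simp only [map_smul, zeta_M, smul_eq_mul, mul_ite, mul_one, mul_zero]
  -- The only coarsening of length at most `1`, hence the only term of `eta I` on which `zeta` does
  -- not vanish.
  let T : VComp l := if h : I.len = 0 then I else ⟨[I.total], by
    simp only [List.mem_singleton, forall_eq]
    exact fun h0 => h (len_eq_zero_of_total h0)⟩
  have hT : T.Coarsens I := by
    by_cases h : I.len = 0
    · simp only [T, h, dif_pos]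
      exact VComp.Coarsens.refl I
    · simp only [T, h, dif_neg, not_false_eq_true]
      exact ⟨[I], by simp, rfl⟩
  have hTlen : T.len = if I.len = 0 then 0 else 1 := by
    by_cases h : I.len = 0
    · simp only [T, h, dif_pos, if_pos]
    · simp only [T, h, dif_neg, if_neg, not_false_eq_true]
      rfl
  rw [Finset.sum_eq_single T]
  · rw [hTlen]
    split_ifs <;> simp_all
  · intro J hJ hne
    rw [Set.Finite.mem_toFinset, Set.mem_ofPred_eq] at hJ
    rw [if_neg]
    intro hJl
    refine hne (eq_of_len_le_one hJl ?_ (hJ.total_eq.trans hT.total_eq.symm))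
    rw [hTlen]
    split_ifs <;> simp
  · intro h
    exact absurd ((finite_coarsens I).mem_toFinset.2 hT) h

lemma sum_zeta_signLen_eta (I : VComp l) :
    ∑ k ∈ Finset.range (I.len + 1), zeta l (eta (I.take k)) * signLen l (eta (I.drop k)) =
      if I.len = 0 then 1 else 0 := by
  have h := congrArg (fun φ => φ.ofConv (eta I)) (zetaUnit l).val_inv
  change LinearMap.mul' ℚ ℚ (TensorProduct.map (zeta l) (signLen l) (deconcat l (eta I))) =
    Algebra.linearMap ℚ ℚ (augment l (eta I)) at h
  rw [deconcat_eta, map_sum, map_sum] at h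
  have h2 : augment l (eta I) = if I.len = 0 then 1 else 0 := by
    unfold eta
    rw [map_sum, Finset.sum_eq_single I]
    · rw [map_smul, augment_M]
      split_ifs with h0 <;> simp [h0]
    · intro J hJ hne
      rw [Set.Finite.mem_toFinset, Set.mem_ofPred_eq] at hJ
      rw [map_smul, augment_M, if_neg, smul_zero]
      intro h0
      have hI : I.len = 0 := len_eq_zero_of_total (by
        rw [← hJ.total_eq, VComp.total, VComp.len_eq_zero.1 h0, List.sum_nil])
      exact hne (hJ.eq_of_len_le (by omega))
    · intro h
      exact absurd ((finite_coarsens I).mem_toFinset.2 (VComp.Coarsens.refl I)) h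
  simpa [h2] using h

/-- Since `signLen` is the convolution inverse of `zeta`, applying their product to `eta I`
expresses the value at `I` by the values at proper suffixes; these add up to a geometric sum. -/
lemma signLen_eta (I : VComp l) :
    signLen l (eta I) = if I.len = 0 then 1 else 2 * (-1) ^ I.len := by
  induction hm : I.len using Nat.strong_induction_on generalizing I with
  | _ m ih =>
    have h := sum_zeta_signLen_eta I
    rw [hm, Finset.sum_range_succ', drop_zero] at h
    have h0 : (I.take 0).len = 0 := by simp [len_take]
    rw [zeta_eta, if_pos h0, one_mul] at h
    rcases Nat.eq_zero_or_pos m with rfl | hpos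
    · simpa using h
    obtain ⟨n, rfl⟩ : ∃ n, m = n + 1 := ⟨m - 1, by omega⟩
    rw [if_neg (by omega)] at h ⊢
    have h1 : ∀ k ∈ Finset.range (n + 1), zeta l (eta (I.take (k + 1))) *
        signLen l (eta (I.drop (k + 1))) = if k = n then 2 else 4 * (-1) ^ (n - k) := by
      intro k hk
      rw [Finset.mem_range] at hk
      rw [zeta_eta, len_take, if_neg (by omega), ih (n - k) (by omega) _ (by
        rw [len_drop]; omega)]
      by_cases hkn : k = n
      · simp [hkn]
      · rw [if_neg (by omega), if_neg hkn]
        ring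
    rw [Finset.sum_congr rfl h1, Finset.sum_range_succ, if_pos rfl] at h
    have h2 : ∀ n : ℕ, ∑ k ∈ Finset.range n, (if k = n then (2 : ℚ) else 4 * (-1) ^ (n - k)) =
        -2 + 2 * (-1) ^ n := by
      intro n
      have : ∀ k ∈ Finset.range n, (if k = n then (2 : ℚ) else 4 * (-1) ^ (n - k)) =
          4 * (-1) ^ (n - k) := fun k hk => by
        rw [Finset.mem_range] at hk
        rw [if_neg (by omega)]
      rw [Finset.sum_congr rfl this]
      induction n with
      | zero => simp
      | succ n ihn =>
        rw [Finset.sum_range_succ']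
        simp only [Nat.add_sub_add_right, Nat.sub_zero]
        rw [ihn fun k hk => if_neg (Finset.mem_range.1 hk).ne, pow_succ]
        ring
    rw [h2] at h
    rw [pow_succ]
    linarith

/-! ### The peak algebra is spanned by the functions `η_I` for odd `I` -/

lemma linearIndependent_eta : LinearIndependent ℚ (eta : VComp l → QSym l) := by
  classical
  rw [linearIndependent_iff]
  intro f hf
  by_contra hne
  -- At a longest `I` in the support, no other `eta J` of the relation contains `M I`.
  obtain ⟨I, hI, hmax⟩ := Finset.exists_max_image f.support VComp.len
    (Finsupp.support_nonempty_iff.2 hne)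
  have h := congrArg (fun g => (monoBasis l).repr g I) hf
  rw [Finsupp.linearCombination_apply, Finsupp.sum] at h
  simp only [map_sum, map_smul, Finsupp.finsetSum_apply, Finsupp.smul_apply, repr_eta, map_zero,
    Finsupp.zero_apply, smul_eq_mul] at h
  rw [Finset.sum_eq_single I] at h
  · rw [if_pos (VComp.Coarsens.refl I)] at h
    exact (Finsupp.mem_support_iff.1 hI) (by simpa using h)
  · intro J hJ hJI
    rw [if_neg, mul_zero]
    exact fun hc => hJI (hc.eq_of_len_le (hmax J hJ)).symm
  · exact fun h => absurd hI h

/-- The span of the functions `η_I` for odd `I`. -/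
def oddSpan (l : ℕ) : Submodule ℚ (QSym l) :=
  Submodule.span ℚ (Set.range fun I : {I : VComp l // I.IsOdd} => eta I.1)

lemma eta_mem_oddSpan {I : VComp l} (hI : I.IsOdd) : eta I ∈ oddSpan l :=
  Submodule.subset_span ⟨⟨I, hI⟩, rfl⟩

lemma VComp.IsOdd.neg_one_pow_weight {I : VComp l} (hI : I.IsOdd) :
    (-1 : ℚ) ^ I.weight = (-1) ^ I.len := by
  obtain ⟨L, hL⟩ := I
  unfold VComp.weight VComp.len
  unfold VComp.IsOdd at hI
  change ∀ v ∈ L, Odd (wt v) at hI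
  change (-1 : ℚ) ^ (L.map wt).sum = (-1) ^ L.length
  clear hL
  induction L with
  | nil => rfl
  | cons v L ih =>
    rw [List.map_cons, List.sum_cons, pow_add, List.length_cons, pow_succ,
      ih fun w hw => hI w (by simp [hw]), (hI v (by simp)).neg_one_pow, mul_comm]

/-- Prefixes and suffixes of odd compositions are odd, which makes the span a subcoalgebra. The
characters agree on it because odd columns give weight and length the same parity. -/
lemma oddSpan_le_peakAlgebra (l : ℕ) : oddSpan l ≤ peakAlgebra l := by
  refine (isGreatest_agreeSub _ _ _).2 ⟨⟨?_, ?_⟩, ?_⟩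
  · refine Submodule.span_le.2 ?_
    rintro _ ⟨I, rfl⟩
    exact Submodule.mem_iSup_of_mem I.1.total ⟨eta_mem_oddSpan I.2, eta_mem_homog I.1⟩
  · intro h hh
    have hle : oddSpan l ≤ (Submodule.map₂ (TensorProduct.mk ℚ (QSym l) (QSym l))
        (oddSpan l) (oddSpan l)).comap (deconcat l) := by
      refine Submodule.span_le.2 ?_
      rintro _ ⟨⟨I, hI⟩, rfl⟩
      change deconcat l (eta I) ∈ Submodule.map₂ (TensorProduct.mk ℚ (QSym l) (QSym l)) _ _
      rw [deconcat_eta]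
      exact Submodule.sum_mem _ fun k _ => Submodule.apply_mem_map₂ _
        (eta_mem_oddSpan fun v hv => hI v (List.mem_of_mem_take hv))
        (eta_mem_oddSpan fun v hv => hI v (List.mem_of_mem_drop hv))
    exact hle hh
  · intro h hh
    have hle : oddSpan l ≤ LinearMap.ker (bar (zeta l) - zetaInv l) := by
      refine Submodule.span_le.2 ?_
      rintro _ ⟨⟨I, hI⟩, rfl⟩
      change eta I ∈ LinearMap.ker _
      rw [LinearMap.mem_ker, LinearMap.sub_apply,
        bar_apply_of_mem_homog _ (eta_mem_homog I), zetaInv_eq, signLen_eta, zeta_eta,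
        ← I.weight_eq, hI.neg_one_pow_weight]
      split_ifs with h0
      · simp [h0]
      · ring
    exact sub_eq_zero.1 (hle hh.1)

/-- The contraction of the coproduct with a linear functional on the left factor. -/
noncomputable def contractLeft (φ : QSym l →ₗ[ℚ] ℚ) : QSym l →ₗ[ℚ] QSym l :=
  (TensorProduct.lid ℚ (QSym l)).toLinearMap ∘ₗ φ.rTensor (QSym l) ∘ₗ deconcat l

/-- The contraction of the coproduct with a linear functional on the right factor. -/
noncomputable def contractRight (φ : QSym l →ₗ[ℚ] ℚ) : QSym l →ₗ[ℚ] QSym l :=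
  (TensorProduct.rid ℚ (QSym l)).toLinearMap ∘ₗ φ.lTensor (QSym l) ∘ₗ deconcat l

lemma IsGradedSubcoalgebra.contractLeft_mem {C : Submodule ℚ (QSym l)}
    (hC : IsGradedSubcoalgebra C) (φ : QSym l →ₗ[ℚ] ℚ) {f : QSym l} (hf : f ∈ C) :
    contractLeft φ f ∈ C := by
  have hle : Submodule.map₂ (TensorProduct.mk ℚ (QSym l) (QSym l)) C C ≤
      C.comap ((TensorProduct.lid ℚ (QSym l)).toLinearMap ∘ₗ φ.rTensor (QSym l)) := by
    refine Submodule.map₂_le.2 fun a _ b hb => ?_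
    simpa using C.smul_mem (φ a) hb
  exact hle (hC.comul_mem f hf)

lemma IsGradedSubcoalgebra.contractRight_mem {C : Submodule ℚ (QSym l)}
    (hC : IsGradedSubcoalgebra C) (φ : QSym l →ₗ[ℚ] ℚ) {f : QSym l} (hf : f ∈ C) :
    contractRight φ f ∈ C := by
  have hle : Submodule.map₂ (TensorProduct.mk ℚ (QSym l) (QSym l)) C C ≤
      C.comap ((TensorProduct.rid ℚ (QSym l)).toLinearMap ∘ₗ φ.lTensor (QSym l)) := by
    refine Submodule.map₂_le.2 fun a ha b _ => ?_
    simpa using C.smul_mem (φ b) ha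
  exact hle (hC.comul_mem f hf)

/-- Contracting with the coordinate functional of `M A` strips the prefix `A`, and the result stays
in any subcoalgebra containing `f`. -/
lemma repr_contractLeft (A B : VComp l) (f : QSym l) :
    (monoBasis l).repr (contractLeft ((monoBasis l).coord A) f) B =
      (monoBasis l).repr f (A.append B) := by
  rw [← repr_comul]
  have : (Finsupp.lapply B) ∘ₗ (monoBasis l).repr.toLinearMap ∘ₗ
      (TensorProduct.lid ℚ (QSym l)).toLinearMap ∘ₗ ((monoBasis l).coord A).rTensor (QSym l) =
      (Finsupp.lapply (A, B)) ∘ₗ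
        ((monoBasis l).tensorProduct (monoBasis l)).repr.toLinearMap := by
    refine TensorProduct.ext' fun x y => ?_
    simp [Module.Basis.tensorProduct_repr_tmul_apply, mul_comm]
  exact LinearMap.congr_fun this (deconcat l f)

lemma repr_contractRight (A B : VComp l) (f : QSym l) :
    (monoBasis l).repr (contractRight ((monoBasis l).coord B) f) A =
      (monoBasis l).repr f (A.append B) := by
  rw [← repr_comul]
  have : (Finsupp.lapply A) ∘ₗ (monoBasis l).repr.toLinearMap ∘ₗ
      (TensorProduct.rid ℚ (QSym l)).toLinearMap ∘ₗ ((monoBasis l).coord B).lTensor (QSym l) =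
      (Finsupp.lapply (A, B)) ∘ₗ
        ((monoBasis l).tensorProduct (monoBasis l)).repr.toLinearMap := by
    refine TensorProduct.ext' fun x y => ?_
    simp [Module.Basis.tensorProduct_repr_tmul_apply, mul_comm]
  exact LinearMap.congr_fun this (deconcat l f)

lemma agreeOn_peakAlgebra (l : ℕ) :
    AgreeOn (fun _ => ⊤) (bar (zeta l)) (zetaInv l) (peakAlgebra l) :=
  (isGreatest_agreeSub _ _ _).1

lemma upTo_top (l : ℕ) : upTo (fun _ : Fin l => ⊤) = ⊤ := by
  refine eq_top_iff.2 ((monoBasis l).span_eq.ge.trans (Submodule.span_le.2 ?_))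
  rintro _ ⟨I, rfl⟩
  classical
  refine Submodule.mem_iSup_of_mem ⟨I.total, fun _ => le_top⟩ (mem_homog_iff.2 fun J hJ => ?_)
  change (monoBasis l).repr (M I) J ≠ 0 at hJ
  rw [repr_M] at hJ
  by_cases h : I = J
  · rw [h]
  · simp [h] at hJ

lemma bar_zeta_eq_of_mem {f : QSym l} (hf : f ∈ peakAlgebra l) :
    bar (zeta l) f = signLen l f :=
  (agreeOn_peakAlgebra l).2 f ⟨hf, by rw [upTo_top]; trivial⟩

/-- A homogeneous element of the peak algebra is determined by its coefficients at odd vector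
compositions. -/
lemma eq_zero_of_repr_odd {n : Fin l → ℕ} {f : QSym l} (hf : f ∈ peakAlgebra l)
    (hn : f ∈ homog n) (h : ∀ I : VComp l, I.IsOdd → (monoBasis l).repr f I = 0) : f = 0 := by
  classical
  rw [mem_homog_iff] at hn
  -- Descending induction on the length, starting beyond `wt n`, where no composition has
  -- multidegree `n`.
  have key : ∀ k, ∀ I : VComp l, wt n < I.len + k → (monoBasis l).repr f I = 0 := by
    intro k
    induction k with
    | zero =>
      intro I hI
      by_contra hne
      have h1 := hn I hne
      have h2 : I.len ≤ I.weight := by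
        have h := List.card_nsmul_le_sum (I.1.map wt) 1 (by
          intro x hx
          obtain ⟨v, hv, rfl⟩ := List.mem_map.1 hx
          exact wt_pos (I.2 v hv))
        rw [List.length_map, nsmul_one, Nat.cast_id] at h
        exact h
      rw [I.weight_eq, h1] at h2
      omega
    | succ k ih =>
      intro I hI
      by_cases hodd : I.IsOdd
      · exact h I hodd
      unfold VComp.IsOdd at hodd
      push Not at hodd
      obtain ⟨v, hv, hev⟩ := hodd
      obtain ⟨A, B, hAB⟩ := List.append_of_mem hv
      have hv0 := I.2 v hv
      let A' : VComp l := ⟨A, fun w hw => I.2 w (hAB ▸ List.mem_append_left _ hw)⟩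
      let B' : VComp l := ⟨B, fun w hw => I.2 w (hAB ▸ by simp [hw])⟩
      let V : VComp l := ⟨[v], by simpa using hv0⟩
      have hI' : I = A'.append (V.append B') := Subtype.ext hAB
      -- Stripping everything around the even column `v` leaves an element of the peak algebra of
      -- the multidegree of `v`.
      set g := contractRight ((monoBasis l).coord B') (contractLeft ((monoBasis l).coord A') f)
        with hg
      have hgm : g ∈ peakAlgebra l :=
        (agreeOn_peakAlgebra l).1.contractRight_mem _
          ((agreeOn_peakAlgebra l).1.contractLeft_mem _ hf)
      have hgr : ∀ K, (monoBasis l).repr g K =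
          (monoBasis l).repr f (A'.append (K.append B')) := by
        intro K
        rw [hg, repr_contractRight, repr_contractLeft]
      have hlen : ∀ K : VComp l, (A'.append (K.append B')).len = A'.len + K.len + B'.len := by
        intro K
        simp [VComp.append, VComp.len, add_assoc]
      have htot : ∀ K : VComp l, (A'.append (K.append B')).total =
          A'.total + K.total + B'.total := by
        intro K
        simp [VComp.append, VComp.total, add_assoc]
      by_contra hne
      have hIn := hn I hne
      have hgV : g = (monoBasis l).repr f I • M V := by
        apply (monoBasis l).repr.injective
        ext K
        rw [hgr, map_smul, Finsupp.smul_apply, repr_M]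
        by_cases hK : V = K
        · subst hK
          simp [← hI']
        · rw [if_neg hK, smul_zero]
          by_contra hne'
          have hKn := hn _ hne'
          rw [htot, ← hIn, hI', htot] at hKn
          have hKV : K.total = V.total := add_left_cancel (add_right_cancel hKn)
          -- A composition other than `V` with the same total has at least two columns; inserted
          -- between `A'` and `B'` it is longer than `I`, so the induction hypothesis applies.
          have hK2 : 2 ≤ K.len := by
            by_contra hlt
            exact hK (eq_of_len_le_one le_rfl (by omega) hKV.symm)
          refine hne' (ih _ ?_)
          rw [hI', hlen] at hI
          rw [hlen]
          have : V.len = 1 := rfl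
          omega
      have h3 := bar_zeta_eq_of_mem hgm
      have hVw : V.weight = wt v := by simp [VComp.weight, V]
      have hVl : V.len = 1 := rfl
      -- On `M V` the first character is `1`, as `wt v` is even, and the second is `-1`; the
      -- coefficient equals its negative.
      rw [hgV, map_smul, map_smul, bar_M, zeta_M, signLen_M, hVw, hVl,
        (Nat.not_odd_iff_even.1 hev).neg_one_pow] at h3
      simp only [le_refl, if_true, smul_eq_mul] at h3
      exact hne (by linarith)
  apply (monoBasis l).repr.injective
  ext I
  rw [key (wt n + 1) I (by omega), map_zero, Finsupp.zero_apply]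

lemma mem_oddSpan_of_homog {n : Fin l → ℕ} (k : ℕ) {f : QSym l} (hf : f ∈ peakAlgebra l)
    (hn : f ∈ homog n)
    (h : ∀ I : VComp l, I.IsOdd → k ≤ I.len → (monoBasis l).repr f I = 0) : f ∈ oddSpan l := by
  classical
  induction k generalizing f with
  | zero =>
    rw [eq_zero_of_repr_odd hf hn fun I hI => h I hI (Nat.zero_le _)]
    exact Submodule.zero_mem _
  | succ k ih =>
    set s := ((monoBasis l).repr f).support.filter fun I => I.IsOdd ∧ I.len = k with hs
    -- The coefficient of `M I` in `eta I` is `2 ^ k`, and its other terms are shorter. Subtracting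
    -- `g` removes the odd coefficients of length `k` and creates none of greater length.
    set g := ∑ I ∈ s, ((monoBasis l).repr f I / 2 ^ k) • eta I with hg
    have hgs : g ∈ oddSpan l := Submodule.sum_mem _ fun I hI =>
      Submodule.smul_mem _ _ (eta_mem_oddSpan (Finset.mem_filter.1 hI).2.1)
    have hgn : g ∈ homog n := Submodule.sum_mem _ fun I hI => Submodule.smul_mem _ _ (by
      rw [← mem_homog_iff.1 hn I (Finsupp.mem_support_iff.1 (Finset.mem_filter.1 hI).1)]
      exact eta_mem_homog I)
    rw [← sub_add_cancel f g]
    refine Submodule.add_mem _ (ih (Submodule.sub_mem _ hf (oddSpan_le_peakAlgebra l hgs))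
      (Submodule.sub_mem _ hn hgn) fun J hJ hk => ?_) hgs
    have hgJ : (monoBasis l).repr g J = if J.len = k then (monoBasis l).repr f J else 0 := by
      rw [hg, map_sum, Finsupp.finsetSum_apply]
      have : ∀ I ∈ s, (monoBasis l).repr (((monoBasis l).repr f I / 2 ^ k) • eta I) J =
          if I = J then (monoBasis l).repr f J else 0 := by
        intro I hI
        have hIk := (Finset.mem_filter.1 hI).2.2
        rw [map_smul, Finsupp.smul_apply, repr_eta, smul_eq_mul]
        by_cases hIJ : I = J
        · subst hIJ
          rw [if_pos (VComp.Coarsens.refl I), if_pos rfl, hIk]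
          field_simp
        · rw [if_neg hIJ, if_neg, mul_zero]
          exact fun hc => hIJ (hc.eq_of_len_le (by omega)).symm
      rw [Finset.sum_congr rfl this, Finset.sum_ite_eq']
      by_cases hf0 : (monoBasis l).repr f J = 0
      · simp [hf0]
      · simp [hs, hf0, hJ]
    rw [map_sub, Finsupp.sub_apply, hgJ]
    split_ifs with hJk
    · exact sub_self _
    · rw [h J hJ (by omega), sub_zero]

lemma peakAlgebra_eq_oddSpan (l : ℕ) : peakAlgebra l = oddSpan l := by
  refine le_antisymm ((agreeOn_peakAlgebra l).1.graded.trans (iSup_le fun n f hf => ?_))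
    (oddSpan_le_peakAlgebra l)
  -- Beyond the maximal length in the support the vanishing condition is automatic.
  refine mem_oddSpan_of_homog (((monoBasis l).repr f).support.sup VComp.len + 1) hf.1 hf.2
    fun I _ hI => ?_
  by_contra hne
  have := Finset.le_sup (f := VComp.len) (Finsupp.mem_support_iff.2 hne)
  omega

/-- The basis of the peak algebra formed by the functions `η_I` for odd `I`. -/
noncomputable def etaBasis (l : ℕ) : Module.Basis {I : VComp l // I.IsOdd} ℚ (peakAlgebra l) :=
  (Module.Basis.span (v := fun I : {I : VComp l // I.IsOdd} => eta I.1)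
    (linearIndependent_eta.comp _ Subtype.val_injective)).map
    (LinearEquiv.ofEq _ _ (peakAlgebra_eq_oddSpan l).symm)

lemma coe_etaBasis (I : {I : VComp l // I.IsOdd}) : (etaBasis l I : QSym l) = eta I.1 := by
  rw [etaBasis, Module.Basis.map_apply]
  exact congrArg Subtype.val (Module.Basis.span_apply
    (v := fun I : {I : VComp l // I.IsOdd} => eta I.1)
    (linearIndependent_eta.comp _ Subtype.val_injective) I)

/-! ### The basis of peak functions -/

lemma Admissible.theta_mem {S : Finset ℕ} {u : List (Fin l)} (h : Admissible S u) :
    theta S u ∈ peakAlgebra l := by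
  rw [h.theta_eq]
  exact Submodule.sum_mem _ fun T _ => Submodule.smul_mem _ _
    (oddSpan_le_peakAlgebra l (eta_mem_oddSpan (isOdd_odd _)))

/-- The linear endomorphism of the peak algebra that sends `η_I` to `θ_{S,u}` if the odd vector
composition `I` corresponds to the admissible pair `(S, u)`. -/
noncomputable def etaToTheta (l : ℕ) : peakAlgebra l →ₗ[ℚ] peakAlgebra l :=
  (etaBasis l).constr ℚ fun I =>
    ⟨theta ((admissibleEquiv l).symm I).1.1 ((admissibleEquiv l).symm I).1.2,
      ((admissibleEquiv l).symm I).2.theta_mem⟩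

lemma etaToTheta_eta {S : Finset ℕ} {u : List (Fin l)} (h : Admissible S u)
    (hm : eta (peakComp S u).odd ∈ peakAlgebra l) :
    etaToTheta l ⟨eta (peakComp S u).odd, hm⟩ = ⟨theta S u, h.theta_mem⟩ := by
  have h1 : (⟨eta (peakComp S u).odd, hm⟩ : peakAlgebra l) =
      etaBasis l (admissibleEquiv l ⟨(S, u), h⟩) :=
    Subtype.ext (coe_etaBasis (admissibleEquiv l ⟨(S, u), h⟩)).symm
  rw [h1, etaToTheta, Module.Basis.constr_basis]
  apply Subtype.ext
  simp only [Equiv.symm_apply_apply]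

/-- The expansions of `θ` in `η` and of `η` in `θ` have the same coefficients, so applying the map
twice to `η` returns it. Bijectivity, and with it the basis of peak functions, follows without a
separate independence argument. -/
lemma etaToTheta_involutive (l : ℕ) : Function.Involutive (etaToTheta l) := by
  have : etaToTheta l ∘ₗ etaToTheta l = LinearMap.id := by
    refine (etaBasis l).ext fun I => ?_
    obtain ⟨⟨⟨S, u⟩, h⟩, rfl⟩ := (admissibleEquiv l).surjective I
    have hmem : ∀ T, eta (peakComp T u).odd ∈ peakAlgebra l := fun T =>
      oddSpan_le_peakAlgebra l (eta_mem_oddSpan (isOdd_odd _))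
    have h1 : etaBasis l (admissibleEquiv l ⟨(S, u), h⟩) =
      (⟨eta (peakComp S u).odd, hmem S⟩ : peakAlgebra l) := Subtype.ext (coe_etaBasis _)
    have h2 : (⟨theta S u, h.theta_mem⟩ : peakAlgebra l) =
        ∑ T ∈ S.powerset, (-1 : ℚ) ^ T.card • ⟨eta (peakComp T u).odd, hmem T⟩ := by
      apply Subtype.ext
      rw [Submodule.coe_sum]
      exact h.theta_eq
    rw [LinearMap.comp_apply, h1, etaToTheta_eta h, h2, map_sum, LinearMap.id_apply]
    apply Subtype.ext
    rw [Submodule.coe_sum]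
    obtain ⟨I, hI, -⟩ := h.2
    obtain ⟨hw, hp⟩ := h.tilde_odd hI
    have h3 := (isOdd_odd I).eta_eq
    rw [hw, hp] at h3
    change _ = eta (peakComp S u).odd
    rw [hI.peakComp_eq, h3]
    refine Finset.sum_congr rfl fun T hT => ?_
    rw [map_smul, etaToTheta_eta (h.mono (Finset.mem_powerset.1 hT))]
    rfl
  exact LinearMap.congr_fun this

/-- The basis of the peak algebra formed by the peak functions of admissible pairs. -/
noncomputable def thetaBasis (l : ℕ) :
    Module.Basis {p : Finset ℕ × List (Fin l) // Admissible p.1 p.2} ℚ (peakAlgebra l) :=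
  ((etaBasis l).map (LinearEquiv.ofInvolutive (etaToTheta l) (etaToTheta_involutive l))).reindex
    (admissibleEquiv l).symm

lemma coe_thetaBasis (p : {p : Finset ℕ × List (Fin l) // Admissible p.1 p.2}) :
    (thetaBasis l p : QSym l) = theta p.1.1 p.1.2 := by
  rw [thetaBasis, Module.Basis.reindex_apply, Module.Basis.map_apply]
  change ((etaToTheta l) (etaBasis l (admissibleEquiv l p)) : QSym l) = _
  rw [etaToTheta, Module.Basis.constr_basis]
  simp only [Equiv.symm_apply_apply]

end LevelQSym

theorem mainTheorem4 (l : ℕ) (hl : 0 < l) :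
    (∃ b : Module.Basis {p : Finset ℕ × List (Fin l) // Admissible p.1 p.2} ℚ (peakAlgebra l),
      ∀ p, (b p : QSym l) = theta p.1.1 p.1.2) ∧
    (∀ I : VComp l, I.IsOdd →
      eta I = ∑ S ∈ I.tilde.peakSet.powerset, (-1 : ℚ) ^ S.card • theta S I.word) ∧
    (∀ (S : Finset ℕ) (u : List (Fin l)), Admissible S u →
      (∀ T ⊆ S, ∃! J : VComp l, IsPeakComp T u J) ∧
      theta S u = ∑ T ∈ S.powerset, (-1 : ℚ) ^ T.card • eta (peakComp T u).odd) := by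
  refine ⟨⟨thetaBasis l, coe_thetaBasis⟩, fun I hI => hI.eta_eq, fun S u h =>
    ⟨fun T hT => ?_, h.theta_eq⟩⟩
  obtain ⟨J, hJ, -⟩ := (h.mono hT).2
  exact ⟨J, hJ, fun K hK => hK.unique hJ⟩
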